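/- **Setting.** Let $k\ge 0$ be an integer and let $b:\mathbb R\to\mathbb R$ be $1$-periodic of class $\mathcal C^{2k+2}$. For $x\in\mathbb R$ let $t\mapsto y_x(t)$ be the solution on $\mathbb R$ of $\dot y=b(y)$, $y(0)=x$. Let $T>0$, $0<\Delta t\le T$, let $M\ge1$ be an integer, $\Delta x=1/M$, and $I_i=(i\Delta x,(i+1)\Delta x)$ for $0\le i<M$. Let $V_k$ be the space of functions on $(0,1)$, extended $1$-periodically to $\mathbb R$, whose restriction to each $I_i$ is a polynomial of degree at most $k$. Write $(\cdot,\cdot)$ and $\|\cdot\|$ for the inner product and norm of $L^2(0,1)$, and $M_p(\psi)=\max_{0\le r\le p}\|\psi^{(r)}\|_{L^\infty(0,1)}$. Let $x_{i,1}<\dots<x_{i,p_i}$ be the (finitely many) points $x\in I_i$ for which $y_x(-\Delta t)\in\Delta x\,\mathbb Z$, and put $x_{i,0}=i\Delta x$, $x_{i,p_i+1}=(i+1)\Delta x$. Let $x_\alpha\in(-1,1)$ and $w_\alpha>0$ ($0\le\alpha\le k$) be the points and weights of the Gauss quadrature rule on $(-1,1)$, which is exact for polynomials of degree at most $2k+1$,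 and define $$(f,g)_G=\sum_{i=0}^{M-1}\sum_{q=0}^{p_i}\sum_{\alpha=0}^{k}\tfrac{w_\alpha}{2}(x_{i,q+1}-x_{i,q})\,f(\tilde x^i_{q,\alpha})\,g(\tilde x^i_{q,\alpha}),\qquad \tilde x^i_{q,\alpha}=x_{i,q}+\tfrac{1+x_\alpha}{2}(x_{i,q+1}-x_{i,q}).$$ For a function $f$, let $\mathcal T_{b,\Delta t}f$ and $\widetilde{\mathcal T}_{b,\Delta t}f$ be the elements of $V_k$ such that, for all $\varphi\in V_k$, $$(\mathcal T_{b,\Delta t}f,\varphi)=(f(y_\cdot(-\Delta t)),\varphi),\qquad (\widetilde{\mathcal T}_{b,\Delta t}f,\varphi)=(f(y_\cdot(-\Delta t)),\varphi)_G .$$ **Proposition (Gauss quadrature errors).** There are a constant $C_0\ge0$ depending only on $k$ and a constant $C\ge0$ depending only on $k$, $b$ and $T$ such that, for all $M\ge1$ and all $0<\Delta t\le T$: (i) For all $u,\varphi\in V_k$, $$\big|(u(y_\cdot(-\Delta t)),\varphi)_G-(u(y_\cdot(-\Delta t)),\varphi)\big|\le C\,\Delta t\,\Delta x^2\,\|u\|\,\|\varphi\|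 ;$$ in particular $\|\widetilde{\mathcal T}_{b,\Delta t}u-\mathcal T_{b,\Delta t}u\|\le C\,\Delta t\,\Delta x^2\,\|u\|$ for all $u\in V_k$. (ii) For all $u,\varphi\in V_k$ and all $1$-periodic $\psi\in\mathcal C^{k+1}(\mathbb R)$, $$\big|((u-\psi)(y_\cdot(-\Delta t)),\varphi)_G-((u-\psi)(y_\cdot(-\Delta t)),\varphi)\big|\le C\,\Delta t\,\Delta x^2\,\|u-\psi\|\,\|\varphi\|+C_0\,M_{k+1}(\psi)\,\Delta x^{k+1}\,\|\varphi\| .$$ (iii) For all $\psi\in\mathcal C^{k+1}([0,1])$ and all $\varphi\in V_k$, $$\big|(\psi,\varphi)_G-(\psi,\varphi)\big|\le C_0\,M_{k+1}(\psi)\,\Delta x^{k+1}\,\|\varphi\| .$$ (iv) For all $1$-periodic $\psi\in\mathcal C^{k+1}(\mathbb R)$, $$\|\widetilde{\mathcal T}_{b,\Delta t}\psi-\mathcal T_{b,\Delta t}\psi\|\le C\,M_{k+1}(\psi)\,\Delta x^{k+1} .$$ -/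

import Mathlib

/-! ### Gauss quadrature on `(-1, 1)` -/

namespace SLDG

section Gauss

open Polynomial

/-- Integration of polynomials over `[-1, 1]`. -/
noncomputable def polyInt : ℝ[X] →ₗ[ℝ] ℝ where
  toFun p := ∫ x in (-1 : ℝ)..1, p.eval x
  map_add' p q := by
    simp only [eval_add]
    exact intervalIntegral.integral_add (p.continuous.intervalIntegrable _ _)
      (q.continuous.intervalIntegrable _ _)
  map_smul' c p := by simp

theorem polyInt_pos {p : ℝ[X]} (hp : p ≠ 0) (h : ∀ x ∈ Set.Ioo (-1 : ℝ) 1, 0 ≤ p.eval x) :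
    0 < polyInt p := by
  have hc : ∀ x ∈ Set.Icc (-1 : ℝ) 1, 0 ≤ p.eval x := by
    have : Set.Icc (-1 : ℝ) 1 ⊆ {x | 0 ≤ p.eval x} := by
      rw [← closure_Ioo (by norm_num : (-1 : ℝ) ≠ 1)]
      exact closure_minimal h (isClosed_le continuous_const p.continuous)
    exact this
  obtain ⟨x, hx, hpx⟩ : ∃ x ∈ Set.Icc (-1 : ℝ) 1, p.eval x ≠ 0 := by
    by_contra! hz
    exact hp (p.eq_zero_of_infinite_isRoot
      ((Set.Icc_infinite (by norm_num : (-1 : ℝ) < 1)).mono hz))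
  exact intervalIntegral.integral_pos (by norm_num) p.continuous.continuousOn
    (fun y hy => hc y (Set.Ioc_subset_Icc_self hy)) ⟨x, hx, lt_of_le_of_ne (hc x hx) hpx.symm⟩

theorem exists_orthogonal (n : ℕ) :
    ∃ p : ℝ[X], p ≠ 0 ∧ p.natDegree ≤ n ∧ ∀ g : ℝ[X], g.natDegree < n → polyInt (p * g) = 0 := by
  let Φ : degreeLT ℝ (n + 1) →ₗ[ℝ] (Fin n → ℝ) := LinearMap.pi fun j =>
    polyInt ∘ₗ (LinearMap.mulRight ℝ ((X : ℝ[X]) ^ (j : ℕ))) ∘ₗ (degreeLT ℝ (n + 1)).subtype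
  have hfr : Module.finrank ℝ (degreeLT ℝ (n + 1)) = n + 1 := by
    rw [(degreeLTEquiv ℝ (n + 1)).finrank_eq]; simp
  have : Module.Finite ℝ (degreeLT ℝ (n + 1)) := Module.finite_of_finrank_pos (by omega)
  have hker : LinearMap.ker Φ ≠ ⊥ := LinearMap.ker_ne_bot_of_finrank_lt (by simp [hfr])
  obtain ⟨⟨p, hp⟩, hpk, hp0⟩ := Submodule.exists_mem_ne_zero_of_ne_bot hker
  refine ⟨p, fun h => hp0 (Subtype.ext h), ?_, fun g hg => ?_⟩
  · rw [mem_degreeLT] at hp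
    have := natDegree_lt_iff_degree_lt (n := n + 1) (p := p) (fun h => hp0 (Subtype.ext h))
    exact Nat.lt_succ_iff.mp (this.mpr hp)
  · rw [g.as_sum_range' n hg, Finset.mul_sum, map_sum]
    refine Finset.sum_eq_zero fun j hj => ?_
    have h1 := congrFun (LinearMap.mem_ker.mp hpk) ⟨j, Finset.mem_range.mp hj⟩
    have h2 : polyInt (p * X ^ j) = 0 := h1
    rw [← C_mul_X_pow_eq_monomial, mul_left_comm, ← smul_eq_C_mul, map_smul, h2, smul_zero]

theorem no_signed_factor {n : ℕ} {p f g : ℝ[X]} (hp : p ≠ 0)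
    (horth : ∀ g : ℝ[X], g.natDegree < n → polyInt (p * g) = 0) (hfg : p = f * g)
    (hg : g.natDegree < n)
    (hf : (∀ x ∈ Set.Ioo (-1 : ℝ) 1, 0 ≤ f.eval x) ∨ ∀ x ∈ Set.Ioo (-1 : ℝ) 1, f.eval x ≤ 0) :
    False := by
  have h0 := horth g hg
  have hne : p * g ≠ 0 := mul_ne_zero hp (by rintro rfl; simp at hfg; exact hp hfg)
  have hev : ∀ x, (p * g).eval x = f.eval x * (g.eval x) ^ 2 := fun x => by
    rw [hfg]; simp; ring
  rcases hf with hf | hf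
  · have := polyInt_pos hne fun x hx => by rw [hev]; exact mul_nonneg (hf x hx) (sq_nonneg _)
    linarith
  · have := polyInt_pos (neg_ne_zero.mpr hne) fun x hx => by
      rw [eval_neg, hev]; nlinarith [hf x hx, sq_nonneg (g.eval x)]
    rw [map_neg] at this
    linarith

theorem exists_orthogonal_roots (n : ℕ) :
    ∃ p : ℝ[X], p ≠ 0 ∧ p.natDegree = n ∧
      (∀ g : ℝ[X], g.natDegree < n → polyInt (p * g) = 0) ∧
      p.roots.toFinset.card = n ∧ ∀ x, p.eval x = 0 → x ∈ Set.Ioo (-1 : ℝ) 1 := by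
  obtain ⟨p, hp, hdeg, horth⟩ := exists_orthogonal n
  have hn : p.natDegree = n := by
    by_contra h
    exact no_signed_factor (f := 1) hp horth (one_mul p).symm (by omega) (Or.inl (by simp))
  obtain ⟨q, hq, hcard, hq0⟩ := p.exists_prod_multiset_X_sub_C_mul
  have hprod : (p.roots.map fun a => X - C a).prod.natDegree = p.roots.card :=
    natDegree_multiset_prod_X_sub_C_eq_card _
  have hqne : q ≠ 0 := by rintro rfl; simp at hq; exact hp hq.symm
  have hqd : q.natDegree = 0 := by
    by_contra h
    refine no_signed_factor (f := q) (g := (p.roots.map fun a => X - C a).prod) hp horth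
      (by rw [mul_comm, hq]) (by omega) ?_
    by_contra! hs
    obtain ⟨⟨x, -, hx⟩, y, -, hy⟩ := hs
    obtain ⟨z, hz⟩ := mem_range_of_exists_le_of_exists_ge q.continuous ⟨x, hx.le⟩ ⟨y, hy.le⟩
    have : z ∈ q.roots := (mem_roots hqne).mpr hz
    rw [hq0] at this
    simp at this
  have hfac : ∀ r, p.eval r = 0 → ∃ g : ℝ[X], p = (X - C r) * g ∧ g.natDegree + 1 = n := by
    intro r hr
    obtain ⟨g, hg⟩ := dvd_iff_isRoot.mpr hr
    have hg0 : g ≠ 0 := by rintro rfl; simp at hg; exact hp hg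
    refine ⟨g, hg, ?_⟩
    rw [← hn, hg, natDegree_mul (X_sub_C_ne_zero r) hg0, natDegree_X_sub_C, add_comm]
  have hnodup : p.roots.Nodup := by
    rw [Multiset.nodup_iff_count_le_one]
    intro r
    by_contra! h
    rw [count_roots] at h
    obtain ⟨g, hg⟩ := (le_rootMultiplicity_iff hp).mp h
    have hg0 : g ≠ 0 := by rintro rfl; simp at hg; exact hp hg
    refine no_signed_factor (f := (X - C r) ^ 2) (g := g) hp horth hg ?_
      (Or.inl fun x _ => by simp; positivity)
    have : p.natDegree = 2 + g.natDegree := by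
      rw [hg, natDegree_mul (pow_ne_zero _ (X_sub_C_ne_zero r)) hg0, natDegree_pow,
        natDegree_X_sub_C]
    omega
  refine ⟨p, hp, hn, horth, ?_, fun r hr => ?_⟩
  · rw [Multiset.toFinset_card_of_nodup hnodup]; omega
  · obtain ⟨g, hg, hgd⟩ := hfac r hr
    by_contra h
    refine no_signed_factor (f := X - C r) (g := g) hp horth hg (by omega) ?_
    rw [Set.mem_Ioo, not_and_or, not_lt, not_lt] at h
    rcases h with h | h
    · exact Or.inl fun x hx => by simp; linarith [hx.1]
    · exact Or.inr fun x hx => by simp; linarith [hx.2]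

/-- `ξ 0 < ⋯ < ξ k` and `w 0, …, w k` are the points and weights of the Gauss quadrature rule with
`k + 1` points on `(-1, 1)`. -/
structure IsGaussRule (k : ℕ) (ξ w : Fin (k + 1) → ℝ) : Prop where
  strictMono : StrictMono ξ
  mem_Ioo : ∀ α, ξ α ∈ Set.Ioo (-1 : ℝ) 1
  weight_pos : ∀ α, 0 < w α
  exact_of_natDegree_le : ∀ p : ℝ[X], p.natDegree ≤ 2 * k + 1 →
    ∫ x in (-1 : ℝ)..1, p.eval x = ∑ α, w α * p.eval (ξ α)

theorem exists_isGaussRule (k : ℕ) :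
    ∃ r : (Fin (k + 1) → ℝ) × (Fin (k + 1) → ℝ), IsGaussRule k r.1 r.2 := by
  obtain ⟨p, hp, hn, horth, hcard, hroot⟩ := exists_orthogonal_roots (k + 1)
  let ξ : Fin (k + 1) → ℝ := p.roots.toFinset.orderEmbOfFin hcard
  have hmono : StrictMono ξ := (p.roots.toFinset.orderEmbOfFin hcard).strictMono
  have hξ : ∀ α, p.eval (ξ α) = 0 := fun α => by
    have := p.roots.toFinset.orderEmbOfFin_mem hcard α
    rw [Multiset.mem_toFinset, mem_roots hp] at this
    exact this
  have hinj : Set.InjOn ξ (Finset.univ : Finset (Fin (k + 1))) := hmono.injective.injOn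
  let L : Fin (k + 1) → ℝ[X] := fun α => Lagrange.basis Finset.univ ξ α
  let w : Fin (k + 1) → ℝ := fun α => polyInt (L α)
  have hlow : ∀ g : ℝ[X], g.degree < (k + 1 : ℕ) → polyInt g = ∑ α, w α * g.eval (ξ α) := by
    intro g hg
    have h1 := Lagrange.eq_interpolate (s := Finset.univ) hinj (f := g) (by simpa using hg)
    conv_lhs => rw [h1, Lagrange.interpolate_apply]
    rw [map_sum]
    refine Finset.sum_congr rfl fun α _ => ?_
    rw [← smul_eq_C_mul, map_smul, smul_eq_mul, mul_comm]
  have hall : ∀ g : ℝ[X], g.natDegree ≤ 2 * k + 1 → polyInt g = ∑ α, w α * g.eval (ξ α) := by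
    intro g hg
    have h1 := EuclideanDomain.div_add_mod g p
    have h2 : (g % p).degree < (k + 1 : ℕ) := by
      rw [← hn, ← degree_eq_natDegree hp]; exact EuclideanDomain.mod_lt g hp
    have h3 : (g / p).natDegree < k + 1 := by
      by_cases hlt : g.degree < p.degree
      · rw [(Polynomial.div_eq_zero_iff hp).mpr hlt]; simp
      · have h4 := degree_add_div hp (not_lt.mp hlt)
        have h5 := natDegree_mul hp
          (fun h => hlt ((Polynomial.div_eq_zero_iff hp).mp h))
        have h6 : (p * (g / p)).natDegree = g.natDegree := by
          rw [natDegree, natDegree, degree_mul, h4]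
        omega
    calc polyInt g = polyInt (p * (g / p)) + polyInt (g % p) := by rw [← map_add, h1]
      _ = ∑ α, w α * (g % p).eval (ξ α) := by rw [horth _ h3, zero_add, hlow _ h2]
      _ = _ := by
        refine Finset.sum_congr rfl fun α _ => ?_
        conv_rhs => rw [← h1]
        simp [hξ]
  refine ⟨(ξ, w), hmono, fun α => hroot _ (hξ α), fun α => ?_, hall⟩
  have hd : (L α).natDegree = k := by
    have := Lagrange.natDegree_basis hinj (Finset.mem_univ α); simpa using this
  have h1 := hall (L α ^ 2) (by rw [natDegree_pow, hd]; omega)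
  rw [Finset.sum_eq_single α] at h1
  · have hs : (L α).eval (ξ α) = 1 := Lagrange.eval_basis_self hinj (Finset.mem_univ α)
    simp only [eval_pow, hs, one_pow, mul_one] at h1
    have hL : L α ≠ 0 := Lagrange.basis_ne_zero hinj (Finset.mem_univ α)
    have := polyInt_pos (pow_ne_zero 2 hL) fun x _ => by rw [eval_pow]; positivity
    show 0 < w α
    linarith
  · intro β _ hβ
    have : (L α).eval (ξ β) = 0 := Lagrange.eval_basis_of_ne hβ.symm (Finset.mem_univ β)
    simp [this]
  · simp

end Gauss

/-- The Gauss points `x_0 < ⋯ < x_k` in `(-1, 1)`. -/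
noncomputable def gaussPoint (k : ℕ) : Fin (k + 1) → ℝ := (exists_isGaussRule k).choose.1

/-- The Gauss weights `w_0, …, w_k`. -/
noncomputable def gaussWeight (k : ℕ) : Fin (k + 1) → ℝ := (exists_isGaussRule k).choose.2

theorem isGaussRule (k : ℕ) : IsGaussRule k (gaussPoint k) (gaussWeight k) :=
  (exists_isGaussRule k).choose_spec

/-- The Gauss quadrature rule with `k + 1` points on the interval `(a, c)`, applied to `f`. -/
noncomputable def gaussQuad (k : ℕ) (a c : ℝ) (f : ℝ → ℝ) : ℝ :=
  ∑ α, gaussWeight k α / 2 * (c - a) * f (a + (1 + gaussPoint k α) / 2 * (c - a))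

/-! ### Characteristics -/

theorem exists_characteristic {b : ℝ → ℝ} (hb : ContDiff ℝ 1 b) (hper : Function.Periodic b 1)
    (x : ℝ) : ∃ y : ℝ → ℝ, y 0 = x ∧ ∀ t, HasDerivAt y (b (y t)) t := by
  obtain ⟨B, hB⟩ : ∃ B : NNReal, ∀ z, ‖b z‖ ≤ B := by
    obtain ⟨B, hB⟩ := (isCompact_Icc (a := (0 : ℝ)) (b := 1)).exists_bound_of_continuousOn
      hb.continuous.continuousOn
    refine ⟨B.toNNReal, fun z => ?_⟩
    obtain ⟨z', hz', h⟩ := hper.exists_mem_Ico₀ one_pos z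
    rw [h]
    exact (hB z' (Set.Ico_subset_Icc_self hz')).trans (Real.le_coe_toNNReal B)
  obtain ⟨K, hK⟩ : ∃ K : NNReal, LipschitzWith K b := by
    obtain ⟨K, hK⟩ := (isCompact_Icc (a := (0 : ℝ)) (b := 1)).exists_bound_of_continuousOn
      (hb.continuous_deriv le_rfl).continuousOn
    have hper' : Function.Periodic (deriv b) 1 := fun z => by
      rw [← deriv_comp_add_const]; congr 1; funext u; exact hper u
    refine ⟨K.toNNReal, lipschitzWith_of_nnnorm_deriv_le (hb.differentiable one_ne_zero) fun z => ?_⟩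
    obtain ⟨z', hz', h⟩ := hper'.exists_mem_Ico₀ one_pos z
    rw [h, ← NNReal.coe_le_coe]
    exact (hK z' (Set.Ico_subset_Icc_self hz')).trans (Real.le_coe_toNNReal K)
  have hloc : ∀ a : ℝ, 0 < a → ∃ γ : ℝ → ℝ, γ 0 = x ∧
      ∀ t ∈ Set.Ioo (-a) a, HasDerivAt γ (b (γ t)) t := by
    intro a ha
    have hpl : IsPicardLindelof (fun _ => b) (tmin := -a) (tmax := a)
        ⟨0, by constructor <;> linarith⟩ x (B * a.toNNReal) 0 B K :=
      { lipschitzOnWith := fun _ _ => hK.lipschitzOnWith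
        continuousOn := fun _ _ => continuousOn_const
        norm_le := fun _ _ z _ => hB z
        mul_max_le := by simp [ha.le] }
    obtain ⟨γ, h0, hγ⟩ := hpl.exists_eq_forall_mem_Icc_hasDerivWithinAt₀
    exact ⟨γ, h0, fun t ht => (hγ t (Set.Ioo_subset_Icc_self ht)).hasDerivAt
      (Icc_mem_nhds ht.1 ht.2)⟩
  have hpos : ∀ t : ℝ, 0 < |t| + 1 := fun t => by positivity
  choose! γ h0 hγ using hloc
  have hagree : ∀ a c, 0 < a → a ≤ c → Set.EqOn (γ a) (γ c) (Set.Ioo (-a) a) := by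
    intro a c ha hac
    refine ODE_solution_unique_of_mem_Ioo (v := fun _ => b) (s := fun _ => Set.univ) (K := K)
      (t₀ := 0) (fun _ _ => hK.lipschitzOnWith) ⟨by linarith, ha⟩
      (fun t ht => ⟨hγ a ha t ht, trivial⟩)
      (fun t ht => ⟨hγ c (by linarith) t ⟨by linarith [ht.1], by linarith [ht.2]⟩, trivial⟩) ?_
    rw [h0 a ha, h0 c (by linarith)]
  refine ⟨fun t => γ (|t| + 1) t, h0 _ (hpos 0), fun t => ?_⟩
  have ht : t ∈ Set.Ioo (-(|t| + 1)) (|t| + 1) := by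
    constructor <;> linarith [neg_abs_le t, le_abs_self t]
  refine (hγ _ (hpos t) t ht).congr_of_eventuallyEq ?_
  filter_upwards [isOpen_Ioo.mem_nhds ht] with s hs
  rcases le_total |s| |t| with h | h
  · exact hagree _ _ (hpos s) (by linarith)
      (by constructor <;> linarith [neg_abs_le s, le_abs_self s])
  · exact (hagree _ _ (hpos t) (by linarith) hs).symm

open Classical in
/-- The characteristic `t ↦ y_x(t)`: the solution of `y' = b(y)`, `y(0) = x`, on the whole line. -/
noncomputable def characteristic (b : ℝ → ℝ) (x : ℝ) : ℝ → ℝ :=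
  if h : ∃ y : ℝ → ℝ, y 0 = x ∧ ∀ t, HasDerivAt y (b (y t)) t then h.choose else fun _ => x

theorem characteristic_spec {b : ℝ → ℝ} (hb : ContDiff ℝ 1 b) (hper : Function.Periodic b 1)
    (x : ℝ) : characteristic b x 0 = x ∧
      ∀ t, HasDerivAt (characteristic b x) (b (characteristic b x t)) t := by
  have h := exists_characteristic hb hper x
  rw [characteristic, dif_pos h]
  exact h.choose_spec

/-- The transported function `x ↦ f (y_x(-Δt))`. -/
noncomputable def transport (b : ℝ → ℝ) (Δt : ℝ) (f : ℝ → ℝ) : ℝ → ℝ :=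
  fun x => f (characteristic b x (-Δt))

/-! ### The space `V_k` -/

/-- The `L²(0, 1)` inner product `(f, g)`. -/
noncomputable def innerL2 (f g : ℝ → ℝ) : ℝ := ∫ x in (0 : ℝ)..1, f x * g x

/-- The space `V_k` of discontinuous Galerkin elements on the uniform mesh of `(0, 1)` with `M`
cells `I_i = (i / M, (i + 1) / M)`: functions that are a polynomial of degree at most `k` on each
cell. Elements are extended `1`-periodically to `ℝ`, and the (irrelevant) values at the mesh points
are fixed by continuity from the right, so that each class in `L²` has exactly one
representative. -/
def dgSpace (M k : ℕ) : Submodule ℝ (ℝ → ℝ) where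
  carrier := {u | Function.Periodic u 1 ∧ ∀ i < M, ∃ p : Polynomial ℝ, p.natDegree ≤ k ∧
    ∀ x ∈ Set.Ico ((i : ℝ) / M) (((i : ℝ) + 1) / M), u x = p.eval x}
  add_mem' := by
    rintro u v ⟨hu, hu'⟩ ⟨hv, hv'⟩
    refine ⟨hu.add hv, fun i hi => ?_⟩
    obtain ⟨p, hp, hpu⟩ := hu' i hi
    obtain ⟨q, hq, hqv⟩ := hv' i hi
    exact ⟨p + q, Polynomial.natDegree_add_le_of_degree_le hp hq, fun x hx => by
      simp [hpu x hx, hqv x hx]⟩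
  zero_mem' := ⟨fun _ => rfl, fun _ _ => ⟨0, by simp, by simp⟩⟩
  smul_mem' := by
    rintro c u ⟨hu, hu'⟩
    refine ⟨fun x => by simp [hu x], fun i hi => ?_⟩
    obtain ⟨p, hp, hpu⟩ := hu' i hi
    exact ⟨c • p, (Polynomial.natDegree_smul_le c p).trans hp, fun x hx => by simp [hpu x hx]⟩

theorem dgSpace_cell_integrable {M k : ℕ} {u v : ℝ → ℝ} (hu : u ∈ dgSpace M k)
    (hv : v ∈ dgSpace M k) {i : ℕ} (hi : i < M) :
    IntervalIntegrable (fun x => u x * v x) MeasureTheory.volume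
      ((i : ℝ) / M) (((i + 1 : ℕ) : ℝ) / M) := by
  obtain ⟨p, -, hp⟩ := hu.2 i hi
  obtain ⟨q, -, hq⟩ := hv.2 i hi
  have hle : (i : ℝ) / M ≤ ((i + 1 : ℕ) : ℝ) / M := by
    gcongr; exact_mod_cast Nat.le_succ i
  refine ((p * q).continuous.intervalIntegrable _ _).congr_uIoo fun x hx => ?_
  rw [Set.uIoo_of_le hle] at hx
  have hx' : x ∈ Set.Ico ((i : ℝ) / M) (((i : ℝ) + 1) / M) := by
    push_cast at hx; exact Set.Ioo_subset_Ico_self hx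
  simp [hp x hx', hq x hx']

theorem dgSpace_integrable {M k : ℕ} (hM : 0 < M) {u v : ℝ → ℝ} (hu : u ∈ dgSpace M k)
    (hv : v ∈ dgSpace M k) :
    IntervalIntegrable (fun x => u x * v x) MeasureTheory.volume 0 1 := by
  have := IntervalIntegrable.trans_iterate (a := fun i : ℕ => (i : ℝ) / M) (n := M)
    fun i hi => dgSpace_cell_integrable hu hv hi
  have hM' : (M : ℝ) ≠ 0 := by positivity
  simpa [hM'] using this

theorem dgSpace_exists_cell {M : ℕ} (hM : 0 < M) {x : ℝ} (hx : x ∈ Set.Ico (0 : ℝ) 1) :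
    ∃ i < M, x ∈ Set.Ico ((i : ℝ) / M) (((i : ℝ) + 1) / M) := by
  have hM' : (0 : ℝ) < M := by positivity
  have h0 : 0 ≤ x * M := mul_nonneg hx.1 hM'.le
  refine ⟨⌊x * M⌋₊, ?_, ?_, ?_⟩
  · rw [Nat.floor_lt h0]; nlinarith [hx.2]
  · rw [div_le_iff₀ hM']; exact Nat.floor_le h0
  · rw [lt_div_iff₀ hM']; exact Nat.lt_floor_add_one _

theorem dgSpace_ext {M k : ℕ} (hM : 0 < M) {u : ℝ → ℝ} (hu : u ∈ dgSpace M k)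
    (h : ∀ i < M, ∀ x ∈ Set.Ico ((i : ℝ) / M) (((i : ℝ) + 1) / M), u x = 0) : u = 0 := by
  funext x
  obtain ⟨y, hy, hxy⟩ := hu.1.exists_mem_Ico₀ one_pos x
  obtain ⟨i, hi, hyi⟩ := dgSpace_exists_cell hM hy
  rw [hxy, h i hi y hyi, Pi.zero_apply]

theorem dgSpace_finite {M k : ℕ} (hM : 0 < M) : Module.Finite ℝ (dgSpace M k) := by
  have hM' : (0 : ℝ) < M := by positivity
  let E : dgSpace M k →ₗ[ℝ] (Fin M → Fin (k + 1) → ℝ) := LinearMap.pi fun i => LinearMap.pi fun j =>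
    (LinearMap.proj (((i : ℕ) + ((j : ℕ) : ℝ) / (k + 1)) / M : ℝ)) ∘ₗ (dgSpace M k).subtype
  refine Module.Finite.of_injective E ((injective_iff_map_eq_zero E).mpr ?_)
  rintro ⟨u, hu⟩ hE
  refine Subtype.ext (dgSpace_ext hM hu fun i hi => ?_)
  obtain ⟨p, hpd, hp⟩ := hu.2 i hi
  have hp0 : p = 0 := by
    refine Polynomial.eq_zero_of_natDegree_lt_card_of_eval_eq_zero p
      (f := fun j : Fin (k + 1) => (((i : ℕ) + ((j : ℕ) : ℝ) / (k + 1)) / M : ℝ)) ?_ ?_ ?_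
    · intro j j' h
      have hk : (0 : ℝ) < k + 1 := by positivity
      field_simp at h
      exact Fin.ext (by exact_mod_cast (add_left_cancel h))
    · intro j
      have h1 : u (((i : ℕ) + ((j : ℕ) : ℝ) / (k + 1)) / M : ℝ) = 0 :=
        congrFun (congrFun hE ⟨i, hi⟩) j
      rw [← h1]
      refine (hp _ ⟨?_, ?_⟩).symm
      · gcongr; exact le_add_of_nonneg_right (by positivity)
      · gcongr
        rw [div_lt_one (by positivity)]
        exact_mod_cast j.2
    · simpa using Nat.lt_succ_of_le hpd
  intro x hx
  simp [hp x hx, hp0]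

theorem innerL2_self_eq_zero {M k : ℕ} (hM : 0 < M) {u : ℝ → ℝ} (hu : u ∈ dgSpace M k)
    (h : innerL2 u u = 0) : u = 0 := by
  have hM' : (0 : ℝ) < M := by positivity
  refine dgSpace_ext hM hu fun i hi => ?_
  obtain ⟨p, hpd, hp⟩ := hu.2 i hi
  have hlt : (i : ℝ) / M < (((i + 1 : ℕ) : ℝ)) / M := by
    gcongr; exact_mod_cast Nat.lt_succ_self i
  have hcell : ∀ j < M, 0 ≤ ∫ x in ((j : ℝ) / M)..(((j + 1 : ℕ) : ℝ) / M), u x * u x := fun j _ =>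
    intervalIntegral.integral_nonneg (by gcongr; exact_mod_cast Nat.le_succ j)
      fun x _ => mul_self_nonneg _
  have hsum : ∑ j ∈ Finset.range M, ∫ x in ((j : ℝ) / M)..(((j + 1 : ℕ) : ℝ) / M), u x * u x = 0 := by
    have := intervalIntegral.sum_integral_adjacent_intervals (a := fun i : ℕ => (i : ℝ) / M) (n := M)
      fun j hj => dgSpace_cell_integrable hu hu hj
    rw [this]
    simpa [hM'.ne', innerL2] using h
  have h0 := (Finset.sum_eq_zero_iff_of_nonneg
    (fun j hj => hcell j (Finset.mem_range.mp hj))).mp hsum i (Finset.mem_range.mpr hi)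
  have h1 : ∫ x in ((i : ℝ) / M)..(((i + 1 : ℕ) : ℝ) / M), p.eval x * p.eval x = 0 := by
    rw [← h0]
    refine intervalIntegral.integral_congr_uIoo fun x hx => ?_
    rw [Set.uIoo_of_le hlt.le] at hx
    have hx' : x ∈ Set.Ico ((i : ℝ) / M) (((i : ℝ) + 1) / M) := by
      push_cast at hx; exact Set.Ioo_subset_Ico_self hx
    simp [hp x hx']
  intro x hx
  rw [hp x hx]
  by_contra hne
  have : 0 < ∫ y in ((i : ℝ) / M)..(((i + 1 : ℕ) : ℝ) / M), p.eval y * p.eval y :=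
    intervalIntegral.integral_pos hlt
      (p.continuous.mul p.continuous).continuousOn (fun y _ => mul_self_nonneg (p.eval y))
      ⟨x, by push_cast; exact Set.Ico_subset_Icc_self hx, mul_self_pos.mpr hne⟩
  linarith

/-- Every linear functional on `V_k` is represented by exactly one element of `V_k`. -/
theorem dgSpace_existsUnique {M k : ℕ} (hM : 0 < M) (ℓ : dgSpace M k →ₗ[ℝ] ℝ) :
    ∃! w : dgSpace M k, ∀ φ : dgSpace M k, innerL2 w φ = ℓ φ := by
  have := dgSpace_finite (k := k) hM
  let B : dgSpace M k →ₗ[ℝ] (dgSpace M k →ₗ[ℝ] ℝ) := LinearMap.mk₂ ℝ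
    (fun w φ => innerL2 w φ)
    (fun u v w => by
      simp only [innerL2, Submodule.coe_add, Pi.add_apply, add_mul]
      exact intervalIntegral.integral_add (dgSpace_integrable hM u.2 w.2)
        (dgSpace_integrable hM v.2 w.2))
    (fun c u w => by
      simp [innerL2, mul_assoc])
    (fun u v w => by
      simp only [innerL2, Submodule.coe_add, Pi.add_apply, mul_add]
      exact intervalIntegral.integral_add (dgSpace_integrable hM u.2 v.2)
        (dgSpace_integrable hM u.2 w.2))
    (fun c u w => by
      simp [innerL2, mul_left_comm])
  have hinj : Function.Injective B := (injective_iff_map_eq_zero B).mpr fun u hu =>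
    Subtype.ext (innerL2_self_eq_zero hM u.2 (LinearMap.congr_fun hu u))
  have hsurj : Function.Surjective B :=
    (LinearMap.injective_iff_surjective_of_finrank_eq_finrank
      (Subspace.dual_finrank_eq (K := ℝ) (V := dgSpace M k)).symm).mp hinj
  obtain ⟨w, hw⟩ := hsurj ℓ
  exact ⟨w, fun φ => LinearMap.congr_fun hw φ, fun v hv =>
    hinj (by rw [hw]; exact LinearMap.ext hv)⟩

/-- The `L²(0, 1)` norm. -/
noncomputable def normL2 (f : ℝ → ℝ) : ℝ := Real.sqrt (∫ x in (0 : ℝ)..1, f x ^ 2)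

/-- `M_p(ψ) = max_{0 ≤ r ≤ p} ‖ψ^(r)‖_{L^∞(0, 1)}`. -/
noncomputable def maxDeriv (p : ℕ) (ψ : ℝ → ℝ) : ℝ :=
  (Finset.range (p + 1)).sup' ⟨0, by simp⟩ fun r =>
    (MeasureTheory.eLpNorm (iteratedDeriv r ψ) ⊤
      (MeasureTheory.volume.restrict (Set.Ioo (0 : ℝ) 1))).toReal

/-! ### The quadrature form and the two schemes -/

/-- The points `x_{i,1}, …, x_{i,p_i}` of the open cell `I_i` whose characteristic starts, at time
`-Δt`, from a mesh point. -/
def breakPoints (b : ℝ → ℝ) (Δt : ℝ) (M i : ℕ) : Set ℝ :=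
  {x | x ∈ Set.Ioo ((i : ℝ) / M) (((i : ℝ) + 1) / M) ∧
    ∃ l : ℤ, characteristic b x (-Δt) = (l : ℝ) / M}

open Classical in
/-- The set `{x_{i,0}, …, x_{i,p_i+1}}` of the break points and the two end points of the cell
`I_i`. (There are finitely many break points, since `x ↦ y_x(-Δt)` is continuous and strictly
increasing.) -/
noncomputable def cellNodes (b : ℝ → ℝ) (Δt : ℝ) (M i : ℕ) : Finset ℝ :=
  {(i : ℝ) / M, ((i : ℝ) + 1) / M} ∪
    if h : (breakPoints b Δt M i).Finite then h.toFinset else ∅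

/-- The node `x_{i,q}`: the nodes of the cell `I_i` in increasing order, numbered from `0`. -/
noncomputable def cellNode (b : ℝ → ℝ) (Δt : ℝ) (M i q : ℕ) : ℝ :=
  ((cellNodes b Δt M i).sort (· ≤ ·)).getD q 0

/-- The quadrature form `(f, g)_G`: on each cell `I_i`, the Gauss rule with `k + 1` points is
applied to `f g` on each of the `p_i + 1` intervals `(x_{i,q}, x_{i,q+1})`. -/
noncomputable def innerG (b : ℝ → ℝ) (Δt : ℝ) (M k : ℕ) (f g : ℝ → ℝ) : ℝ :=
  ∑ i ∈ Finset.range M, ∑ q ∈ Finset.range ((cellNodes b Δt M i).card - 1),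
    gaussQuad k (cellNode b Δt M i q) (cellNode b Δt M i (q + 1)) fun x => f x * g x

open Classical in
/-- The element `w` of `V_k` with `(w, φ) = ℓ φ` for all `φ ∈ V_k`. -/
noncomputable def dgElement (M k : ℕ) (ℓ : (ℝ → ℝ) → ℝ) : ℝ → ℝ :=
  if h : ∃ w ∈ dgSpace M k, ∀ φ ∈ dgSpace M k, innerL2 w φ = ℓ φ then h.choose else 0

/-- `dgElement` has its defining property for every functional that is linear on `V_k`. -/
theorem dgElement_spec {M k : ℕ} (hM : 0 < M) {ℓ : (ℝ → ℝ) → ℝ}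
    (hadd : ∀ φ ∈ dgSpace M k, ∀ χ ∈ dgSpace M k, ℓ (φ + χ) = ℓ φ + ℓ χ)
    (hsmul : ∀ (c : ℝ), ∀ φ ∈ dgSpace M k, ℓ (c • φ) = c * ℓ φ) :
    dgElement M k ℓ ∈ dgSpace M k ∧
      ∀ φ ∈ dgSpace M k, innerL2 (dgElement M k ℓ) φ = ℓ φ := by
  have h : ∃ w ∈ dgSpace M k, ∀ φ ∈ dgSpace M k, innerL2 w φ = ℓ φ := by
    obtain ⟨w, hw, -⟩ := dgSpace_existsUnique hM
      ({ toFun := fun φ => ℓ φ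
         map_add' := fun φ χ => hadd φ φ.2 χ χ.2
         map_smul' := fun c φ => hsmul c φ φ.2 } : dgSpace M k →ₗ[ℝ] ℝ)
    exact ⟨w, w.2, fun φ hφ => hw ⟨φ, hφ⟩⟩
  rw [dgElement, dif_pos h]
  exact h.choose_spec

/-- The exact scheme `𝒯_{b,Δt}`: `(𝒯 f, φ) = (f(y_·(-Δt)), φ)` for all `φ ∈ V_k`. -/
noncomputable def exactScheme (b : ℝ → ℝ) (Δt : ℝ) (M k : ℕ) (f : ℝ → ℝ) : ℝ → ℝ :=
  dgElement M k fun φ => innerL2 (transport b Δt f) φ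

/-- The implemented scheme `𝒯̃_{b,Δt}`: `(𝒯̃ f, φ) = (f(y_·(-Δt)), φ)_G` for all `φ ∈ V_k`. -/
noncomputable def quadScheme (b : ℝ → ℝ) (Δt : ℝ) (M k : ℕ) (f : ℝ → ℝ) : ℝ → ℝ :=
  dgElement M k fun φ => innerG b Δt M k (transport b Δt f) φ

end SLDG

/-! The Gauss rule with `k + 1` points is exact up to degree `2k + 1` and `φ` has degree at most `k`
on each quadrature interval. Hence the error for `f φ` vanishes when `f` is a polynomial of degree
`k + 1`, and in general it is governed by the uniform distance from `f` to such polynomials. The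
supremum of `φ` is paid for by its local `L²` norm, all norms on polynomials of bounded degree being
equivalent after rescaling (`exists_gaussQuad_error_le`).

Let `Y = flow b s` with `s = Δt`. Between two nodes, `Y` meets no mesh point, so `u ∘ Y = p ∘ Y` for
one polynomial `p` of degree at most `k`. Since `Y - id` is minus a time integral over `[0, s]`, its
`x`-derivatives are `O(s)`. On an interval of length `h` with left end `a`, in the variable `t = (x
- a) / h`, the rescaled flow is `α t + β h t² + O(s h²)` with `β = O(s)`. Expanding `p` about `α t`,
the zeroth order term and the product of `p'` with `β h t²` have degree at most `k + 1`. They are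
integrated exactly against `φ`, and what remains is `O(s h²)` (`exists_comp_flow_approx`). This is
the origin of the factor `Δt Δx²`.

With a smooth `ψ` subtracted, `ψ` is replaced by a Taylor polynomial `Q` on the image interval, at a
cost `μ` of order `Δx^(k+1)`. The estimate for `p - Q` then contributes `s h² μ` with a constant
depending on `b` and `T`; a case distinction on the size of that factor keeps the constant in front
of `μ` dependent on `k` alone (`exists_interval_error_le`).

Local errors are added by Cauchy–Schwarz. The intervals tile `(0, 1)`, and their images tile one
period because `Y (x + 1) = Y x + 1`, so the local norms of `φ` and of `u - ψ` recombine into global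
ones. Statement (i) is (ii) with `ψ = 0`; (iii) uses Taylor polynomials of `ψ` directly, and (iv)
those of `ψ ∘ Y`. Bounds on schemes follow by testing with their difference. -/

/-! ### The flow of `b` and its dependence on the initial point -/

namespace SLDG

open Set Filter Topology MeasureTheory

/-- The mean slope `∫₀¹ b'(y₀ + τ (y - y₀)) dτ` of `b` between `y₀` and `y`. -/
noncomputable def meanSlope (b : ℝ → ℝ) (y₀ y : ℝ) : ℝ :=
  ∫ τ in (0 : ℝ)..1, deriv b (y₀ + τ * (y - y₀))

theorem meanSlope_self (b : ℝ → ℝ) (y : ℝ) : meanSlope b y y = deriv b y := by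
  simp [meanSlope]

/-- The fundamental theorem of calculus on the segment from `y₀` to `y`. Unlike the difference
quotient, the mean slope is continuous across the diagonal, which later allows the limit in the
derivative of the flow. -/
theorem meanSlope_mul {b : ℝ → ℝ} (hb : ContDiff ℝ 1 b) (y₀ y : ℝ) :
    b y - b y₀ = meanSlope b y₀ y * (y - y₀) := by
  have hd : ∀ τ : ℝ, HasDerivAt (fun τ => b (y₀ + τ * (y - y₀)))
      (deriv b (y₀ + τ * (y - y₀)) * (y - y₀)) τ := fun τ => by
    have h1 := ((hb.differentiable one_ne_zero) (y₀ + τ * (y - y₀))).hasDerivAt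
    have h2 : HasDerivAt (fun τ : ℝ => y₀ + τ * (y - y₀)) (y - y₀) τ := by
      simpa using ((hasDerivAt_id τ).mul_const (y - y₀)).const_add y₀
    exact h1.comp τ h2
  have hc : Continuous (deriv b) := hb.continuous_deriv le_rfl
  have := intervalIntegral.integral_eq_sub_of_hasDerivAt (a := 0) (b := 1) (fun τ _ => hd τ)
    ((by fun_prop : Continuous fun τ : ℝ =>
      deriv b (y₀ + τ * (y - y₀)) * (y - y₀)).intervalIntegrable _ _)
  rw [intervalIntegral.integral_mul_const] at this
  rw [meanSlope, this]
  simp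

theorem continuous_meanSlope {b : ℝ → ℝ} (hb : ContDiff ℝ 1 b) :
    Continuous fun p : ℝ × ℝ => meanSlope b p.1 p.2 := by
  have hc : Continuous (deriv b) := hb.continuous_deriv le_rfl
  unfold meanSlope
  apply intervalIntegral.continuous_parametric_intervalIntegral_of_continuous'
  fun_prop

/-- A periodic continuous function is bounded. -/
theorem exists_bound_of_periodic {f : ℝ → ℝ} (hf : Continuous f) (hper : Function.Periodic f 1) :
    ∃ B, 0 ≤ B ∧ ∀ x, |f x| ≤ B := by
  obtain ⟨B, hB⟩ := (isCompact_Icc (a := (0 : ℝ)) (b := 1)).exists_bound_of_continuousOn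
    hf.continuousOn
  refine ⟨B, (norm_nonneg _).trans (hB 0 (by simp)), fun x => ?_⟩
  obtain ⟨x', hx', h⟩ := hper.exists_mem_Ico₀ one_pos x
  rw [h]
  exact hB x' (Ico_subset_Icc_self hx')

theorem periodic_deriv {f : ℝ → ℝ} (hper : Function.Periodic f 1) :
    Function.Periodic (deriv f) 1 := fun z => by
  rw [← deriv_comp_add_const]; congr 1; funext u; exact hper u

theorem periodic_iteratedDeriv {f : ℝ → ℝ} (hper : Function.Periodic f 1) (n : ℕ) :
    Function.Periodic (iteratedDeriv n f) 1 := by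
  induction n with
  | zero => simpa using hper
  | succ n ih => rw [iteratedDeriv_succ]; exact periodic_deriv ih

theorem abs_meanSlope_le {b : ℝ → ℝ} {K : ℝ} (hK : ∀ x, |deriv b x| ≤ K) (y₀ y : ℝ) :
    |meanSlope b y₀ y| ≤ K := by
  have := intervalIntegral.norm_integral_le_of_norm_le_const (a := (0 : ℝ)) (b := 1) (C := K)
    (f := fun τ => deriv b (y₀ + τ * (y - y₀))) (fun τ _ => hK _)
  simpa [meanSlope] using this

/-- The backward flow `y_x(-s)`. -/
noncomputable def flow (b : ℝ → ℝ) (s x : ℝ) : ℝ := characteristic b x (-s)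

/-! ### Regularity of the backward flow in its initial point. -/

section Flow

variable {b : ℝ → ℝ} (hb : ContDiff ℝ 1 b) (hper : Function.Periodic b 1)

include hb hper

theorem flow_zero (x : ℝ) : flow b 0 x = x := by
  simpa [flow] using (characteristic_spec hb hper x).1

theorem hasDerivAt_flow_time (s x : ℝ) :
    HasDerivAt (fun s => flow b s x) (-b (flow b s x)) s := by
  have h := ((characteristic_spec hb hper x).2 (-s)).comp s (hasDerivAt_neg s)
  simpa [flow, Function.comp_def] using h

theorem continuous_flow_time (x : ℝ) : Continuous fun s => flow b s x :=
  continuous_iff_continuousAt.mpr fun s => (hasDerivAt_flow_time hb hper s x).continuousAt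

omit hper in
/-- The difference of two solutions of `y' = -b(y)`. -/
theorem sub_eq_mul_exp {y z : ℝ → ℝ} (hy : ∀ s, HasDerivAt y (-b (y s)) s)
    (hz : ∀ s, HasDerivAt z (-b (z s)) s) (s : ℝ) :
    y s - z s = (y 0 - z 0) * Real.exp (-∫ r in (0 : ℝ)..s, meanSlope b (z r) (y r)) := by
  have hyc : Continuous y := continuous_iff_continuousAt.mpr fun s => (hy s).continuousAt
  have hzc : Continuous z := continuous_iff_continuousAt.mpr fun s => (hz s).continuousAt
  have hg : Continuous fun r => meanSlope b (z r) (y r) :=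
    (continuous_meanSlope hb).comp (hzc.prodMk hyc)
  let I : ℝ → ℝ := fun s => ∫ r in (0 : ℝ)..s, meanSlope b (z r) (y r)
  have hI : ∀ s, HasDerivAt I (meanSlope b (z s) (y s)) s := fun s =>
    hg.integral_hasStrictDerivAt 0 s |>.hasDerivAt
  -- The difference satisfies the linear equation `(y - z)' = -m (y - z)`, with `m` the mean slope
  -- along the two solutions, so `exp (∫ m)` is an integrating factor.
  have hd : ∀ s, HasDerivAt (fun s => (y s - z s) * Real.exp (I s)) 0 s := fun s => by
    refine (((hy s).sub (hz s)).mul (hI s).exp).congr_deriv ?_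
    have h := meanSlope_mul hb (z s) (y s)
    simp only [Pi.sub_apply]
    linear_combination (-Real.exp (I s)) * h
  have hconst := is_const_of_deriv_eq_zero (fun s => (hd s).differentiableAt)
    (fun s => (hd s).deriv) s 0
  have hI0 : I 0 = 0 := by simp [I]
  simp only [hI0, Real.exp_zero, mul_one] at hconst
  rw [← hconst, mul_assoc, ← Real.exp_add]
  simp [I]

/-- This identity takes the place of Gronwall's inequality: monotonicity, Lipschitz bounds from both
sides and the derivative in `x` are all read off from it. -/
theorem flow_sub (s x x₀ : ℝ) : flow b s x - flow b s x₀ =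
    (x - x₀) * Real.exp (-∫ r in (0 : ℝ)..s, meanSlope b (flow b r x₀) (flow b r x)) := by
  have := sub_eq_mul_exp hb (fun s => hasDerivAt_flow_time hb hper s x)
    (fun s => hasDerivAt_flow_time hb hper s x₀) s
  rwa [flow_zero hb hper, flow_zero hb hper] at this

/-- By periodicity of `b`, the shifted solution solves the same equation with the same initial
value; the exponential formula then makes the difference vanish. -/
theorem flow_add_one (s x : ℝ) : flow b s (x + 1) = flow b s x + 1 := by
  have := sub_eq_mul_exp hb (y := fun s => flow b s (x + 1)) (z := fun s => flow b s x + 1)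
    (fun s => hasDerivAt_flow_time hb hper s (x + 1))
    (fun s => by rw [hper]; exact (hasDerivAt_flow_time hb hper s x).add_const 1) s
  rw [flow_zero hb hper, flow_zero hb hper] at this
  linarith [this]

theorem flow_strictMono (s : ℝ) : StrictMono (flow b s) := fun x₀ x h => by
  have h1 := flow_sub hb hper s x x₀
  have : 0 < (x - x₀) * Real.exp
      (-∫ r in (0 : ℝ)..s, meanSlope b (flow b r x₀) (flow b r x)) :=
    mul_pos (by linarith) (Real.exp_pos _)
  linarith

theorem exists_flow_lipschitz : ∃ K, 0 ≤ K ∧ ∀ s x x₀,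
    |flow b s x - flow b s x₀| ≤ |x - x₀| * Real.exp (K * |s|) := by
  obtain ⟨K, hK0, hK⟩ := exists_bound_of_periodic (hb.continuous_deriv le_rfl) (periodic_deriv hper)
  refine ⟨K, hK0, fun s x x₀ => ?_⟩
  rw [flow_sub hb hper, abs_mul, abs_of_pos (Real.exp_pos _)]
  gcongr
  have := intervalIntegral.norm_integral_le_of_norm_le_const (a := (0 : ℝ)) (b := s) (C := K)
    (f := fun r => meanSlope b (flow b r x₀) (flow b r x)) (fun r _ => abs_meanSlope_le hK _ _)
  rw [sub_zero, Real.norm_eq_abs] at this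
  exact (neg_le_abs _).trans this

/-- Continuity in time at the fixed point `x₀` combines with the Lipschitz bound in `x`, whose
constant is locally uniform in time. -/
theorem continuous_flow : Continuous fun p : ℝ × ℝ => flow b p.1 p.2 := by
  obtain ⟨K, hK0, hK⟩ := exists_flow_lipschitz hb hper
  rw [continuous_iff_continuousAt]
  rintro ⟨s₀, x₀⟩
  rw [ContinuousAt, tendsto_iff_dist_tendsto_zero]
  refine squeeze_zero (fun _ => dist_nonneg) (g := fun p : ℝ × ℝ =>
    |p.2 - x₀| * Real.exp (K * |p.1|) + |flow b p.1 x₀ - flow b s₀ x₀|) (fun p => ?_) ?_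
  · rw [Real.dist_eq]
    exact (abs_sub_le _ (flow b p.1 x₀) _).trans (by gcongr; exact hK _ _ _)
  · have hc := continuous_flow_time hb hper x₀
    have : Continuous (fun p : ℝ × ℝ =>
      |p.2 - x₀| * Real.exp (K * |p.1|) + |flow b p.1 x₀ - flow b s₀ x₀|) := by
      have := hc.comp (continuous_fst (X := ℝ) (Y := ℝ))
      simp only [Function.comp_def] at this
      fun_prop
    simpa using this.tendsto (s₀, x₀)

/-- By `flow_sub` the difference quotient is an exponential that is continuous in `x` up to `x =
x₀`, where the mean slope becomes `b'`. -/
theorem hasDerivAt_flow (s x₀ : ℝ) : HasDerivAt (flow b s)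
    (Real.exp (-∫ r in (0 : ℝ)..s, deriv b (flow b r x₀))) x₀ := by
  have hc : Continuous fun x =>
      Real.exp (-∫ r in (0 : ℝ)..s, meanSlope b (flow b r x₀) (flow b r x)) := by
    refine Real.continuous_exp.comp (Continuous.neg ?_)
    apply intervalIntegral.continuous_parametric_intervalIntegral_of_continuous'
    have h1 : Continuous fun p : ℝ × ℝ => flow b p.2 p.1 :=
      (continuous_flow hb hper).comp continuous_swap
    have h2 : Continuous fun p : ℝ × ℝ => flow b p.2 x₀ :=
      (continuous_flow_time hb hper x₀).comp continuous_snd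
    exact (continuous_meanSlope hb).comp (h2.prodMk h1)
  rw [hasDerivAt_iff_tendsto_slope]
  have h0 := hc.tendsto x₀
  simp only [meanSlope_self] at h0
  refine (h0.mono_left nhdsWithin_le_nhds).congr' ?_
  filter_upwards [self_mem_nhdsWithin] with x hx
  have hx' : x - x₀ ≠ 0 := sub_ne_zero.mpr hx
  rw [slope_def_field, flow_sub hb hper]
  field_simp

end Flow

/-- `F` and its derivatives of order at most `n` in the second variable are jointly continuous. -/
def JointlySmooth : ℕ → (ℝ → ℝ → ℝ) → Prop
  | 0, F => Continuous fun p : ℝ × ℝ => F p.1 p.2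
  | n + 1, F => (Continuous fun p : ℝ × ℝ => F p.1 p.2) ∧ (∀ s, Differentiable ℝ (F s)) ∧
      JointlySmooth n fun s => deriv (F s)

/-! ### Calculus of jointly continuous spatial derivatives. -/

namespace JointlySmooth

theorem continuous {n : ℕ} {F : ℝ → ℝ → ℝ} (h : JointlySmooth n F) :
    Continuous fun p : ℝ × ℝ => F p.1 p.2 := by
  cases n with
  | zero => exact h
  | succ n => exact h.1

theorem of_succ {n : ℕ} : ∀ {F : ℝ → ℝ → ℝ}, JointlySmooth (n + 1) F → JointlySmooth n F := by
  induction n with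
  | zero => exact fun h => h.1
  | succ n ih => exact fun h => ⟨h.1, h.2.1, ih h.2.2⟩

theorem add {n : ℕ} : ∀ {F G : ℝ → ℝ → ℝ}, JointlySmooth n F → JointlySmooth n G →
    JointlySmooth n fun s x => F s x + G s x := by
  induction n with
  | zero => exact fun hF hG => Continuous.add hF hG
  | succ n ih =>
    intro F G hF hG
    refine ⟨hF.1.add hG.1, fun s => (hF.2.1 s).add (hG.2.1 s), ?_⟩
    have : (fun s => deriv fun x => F s x + G s x) =
        fun s x => deriv (F s) x + deriv (G s) x := by
      funext s x; exact deriv_add (hF.2.1 s x) (hG.2.1 s x)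
    rw [this]
    exact ih hF.2.2 hG.2.2

theorem mul {n : ℕ} : ∀ {F G : ℝ → ℝ → ℝ}, JointlySmooth n F → JointlySmooth n G →
    JointlySmooth n fun s x => F s x * G s x := by
  induction n with
  | zero => exact fun hF hG => Continuous.mul hF hG
  | succ n ih =>
    intro F G hF hG
    refine ⟨hF.1.mul hG.1, fun s => (hF.2.1 s).mul (hG.2.1 s), ?_⟩
    have : (fun s => deriv fun x => F s x * G s x) =
        fun s x => deriv (F s) x * G s x + F s x * deriv (G s) x := by
      funext s x; exact deriv_mul (hF.2.1 s x) (hG.2.1 s x)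
    rw [this]
    exact (ih hF.2.2 hG.of_succ).add (ih hF.of_succ hG.2.2)

theorem comp {n : ℕ} : ∀ {g : ℝ → ℝ} {F : ℝ → ℝ → ℝ}, ContDiff ℝ n g → JointlySmooth n F →
    JointlySmooth n fun s x => g (F s x) := by
  induction n with
  | zero => exact fun hg hF => hg.continuous.comp hF
  | succ n ih =>
    intro g F hg hF
    have hgd : Differentiable ℝ g := hg.differentiable (by simp)
    refine ⟨hg.continuous.comp hF.1, fun s => hgd.comp (hF.2.1 s), ?_⟩
    have : (fun s => deriv fun x => g (F s x)) =
        fun s x => deriv g (F s x) * deriv (F s) x := by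
      funext s x; exact deriv_comp x (hgd _) (hF.2.1 s x)
    rw [this]
    have hg' : ContDiff ℝ n (deriv g) :=
      (contDiff_succ_iff_deriv.mp (by simpa using hg)).2.2
    exact (ih hg' hF.of_succ).mul hF.2.2

theorem hasDerivAt_integral {F : ℝ → ℝ → ℝ} (hF : JointlySmooth 1 F) (s x₀ : ℝ) :
    HasDerivAt (fun x => ∫ r in (0 : ℝ)..s, F r x)
      (∫ r in (0 : ℝ)..s, deriv (F r) x₀) x₀ := by
  obtain ⟨h0, hd, h1⟩ := hF
  have h1' : Continuous fun p : ℝ × ℝ => deriv (F p.1) p.2 := h1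
  obtain ⟨B, hB⟩ := (isCompact_uIcc (a := (0 : ℝ)) (b := s)).prod
    (isCompact_Icc (a := x₀ - 1) (b := x₀ + 1)) |>.exists_bound_of_continuousOn h1'.continuousOn
  have hsec : ∀ x, Continuous fun r => F r x := fun x =>
    h0.comp (continuous_id.prodMk continuous_const)
  have hsec' : ∀ x, Continuous fun r => deriv (F r) x := fun x =>
    h1'.comp (continuous_id.prodMk continuous_const)
  refine (intervalIntegral.hasDerivAt_integral_of_dominated_loc_of_deriv_le
    (F := fun x r => F r x) (F' := fun x r => deriv (F r) x) (bound := fun _ => B)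
    (Icc_mem_nhds (by linarith : x₀ - 1 < x₀) (by linarith : x₀ < x₀ + 1))
    (Eventually.of_forall fun x => (hsec x).aestronglyMeasurable)
    ((hsec x₀).intervalIntegrable _ _) (hsec' x₀).aestronglyMeasurable
    (Eventually.of_forall fun r hr x hx => hB (r, x) ⟨uIoc_subset_uIcc hr, hx⟩)
    (by simp) (Eventually.of_forall fun r _ x _ => (hd r x).hasDerivAt)).2

theorem integral {n : ℕ} : ∀ {F : ℝ → ℝ → ℝ}, JointlySmooth n F →
    JointlySmooth n fun s x => ∫ r in (0 : ℝ)..s, F r x := by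
  have hc : ∀ {F : ℝ → ℝ → ℝ}, (Continuous fun p : ℝ × ℝ => F p.1 p.2) →
      Continuous fun p : ℝ × ℝ => ∫ r in (0 : ℝ)..p.1, F r p.2 := fun {F} hF => by
    refine intervalIntegral.continuous_parametric_intervalIntegral_of_continuous
      (f := fun (p : ℝ × ℝ) r => F r p.2) ?_ continuous_fst
    exact hF.comp (continuous_snd.prodMk (continuous_snd.comp continuous_fst))
  induction n with
  | zero => exact fun hF => hc hF
  | succ n ih =>
    intro F hF
    have h1 : JointlySmooth 1 F := ⟨hF.1, hF.2.1, hF.2.2.continuous⟩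
    refine ⟨hc hF.1, fun s x => (h1.hasDerivAt_integral s x).differentiableAt, ?_⟩
    have : (fun s => deriv fun x => ∫ r in (0 : ℝ)..s, F r x) =
        fun s x => ∫ r in (0 : ℝ)..s, deriv (F r) x := by
      funext s x; exact (h1.hasDerivAt_integral s x).deriv
    rw [this]
    exact ih hF.2.2

theorem contDiff {n : ℕ} : ∀ {F : ℝ → ℝ → ℝ}, JointlySmooth n F → ∀ s, ContDiff ℝ n (F s) := by
  induction n with
  | zero =>
    exact fun {F} hF s => by
      simpa using (contDiff_zero (𝕜 := ℝ) (f := F s)).mpr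
        (hF.continuous.comp (continuous_const.prodMk continuous_id))
  | succ n ih =>
    exact fun hF s => by
      simpa using contDiff_succ_iff_deriv.mpr ⟨hF.2.1 s, by simp, ih hF.2.2 s⟩

theorem continuous_iteratedDeriv {n : ℕ} : ∀ {F : ℝ → ℝ → ℝ}, JointlySmooth n F →
    ∀ {j : ℕ}, j ≤ n → Continuous fun p : ℝ × ℝ => iteratedDeriv j (F p.1) p.2 := by
  induction n with
  | zero =>
    intro F hF j hj
    obtain rfl : j = 0 := by omega
    simpa using hF.continuous
  | succ n ih =>
    intro F hF j hj
    cases j with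
    | zero => simpa using hF.continuous
    | succ j => simpa only [iteratedDeriv_succ'] using ih hF.2.2 (by omega)

theorem iteratedDeriv_integral {n : ℕ} : ∀ {F : ℝ → ℝ → ℝ}, JointlySmooth n F →
    ∀ {j : ℕ}, j ≤ n → ∀ s x, iteratedDeriv j (fun x => ∫ r in (0 : ℝ)..s, F r x) x =
      ∫ r in (0 : ℝ)..s, iteratedDeriv j (F r) x := by
  induction n with
  | zero =>
    intro F hF j hj s x
    obtain rfl : j = 0 := by omega
    simp
  | succ n ih =>
    intro F hF j hj s x
    cases j with
    | zero => simp
    | succ j =>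
      have h1 : JointlySmooth 1 F := ⟨hF.1, hF.2.1, hF.2.2.continuous⟩
      have : (deriv fun x => ∫ r in (0 : ℝ)..s, F r x) =
          fun x => ∫ r in (0 : ℝ)..s, deriv (F r) x := by
        funext x; exact (h1.hasDerivAt_integral s x).deriv
      simp only [iteratedDeriv_succ', this]
      exact ih hF.2.2 (by omega) s x

end JointlySmooth

/-- A bootstrap: `∂ₓY = exp (-∫ b'(Y))` involves `Y` itself and only `b'`, so `n` derivatives of `Y`
and of `b'` yield `n + 1` derivatives of `Y`. -/
theorem jointlySmooth_flow {b : ℝ → ℝ} (hb : ContDiff ℝ 1 b) (hper : Function.Periodic b 1)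
    {n : ℕ} (hn : ContDiff ℝ n b) : JointlySmooth n (flow b) := by
  induction n with
  | zero => exact continuous_flow hb hper
  | succ n ih =>
    have hF := ih (hn.of_le (by exact_mod_cast Nat.le_succ n))
    refine ⟨continuous_flow hb hper,
      fun s x => (hasDerivAt_flow hb hper s x).differentiableAt, ?_⟩
    have : (fun s => deriv (flow b s)) =
        fun s x => Real.exp (-∫ r in (0 : ℝ)..s, deriv b (flow b r x)) := by
      funext s x; exact (hasDerivAt_flow hb hper s x).deriv
    rw [this]
    have hb' : ContDiff ℝ n (deriv b) := (contDiff_succ_iff_deriv.mp (by simpa using hn)).2.2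
    exact (hF.comp hb').integral.comp (g := fun z => Real.exp (-z))
      (Real.contDiff_exp.comp contDiff_neg)

/-- The integral form exhibits `Y - id` as an integral over a time interval of length `s`;
differentiating under the integral preserves this factor. -/
theorem flow_eq_sub_integral {b : ℝ → ℝ} (hb : ContDiff ℝ 1 b) (hper : Function.Periodic b 1)
    (s x : ℝ) : flow b s x = x - ∫ r in (0 : ℝ)..s, b (flow b r x) := by
  have hc : Continuous fun r => -b (flow b r x) :=
    (hb.continuous.comp (continuous_flow_time hb hper x)).neg
  have := intervalIntegral.integral_eq_sub_of_hasDerivAt (a := 0) (b := s)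
    (fun r _ => hasDerivAt_flow_time hb hper r x) (hc.intervalIntegrable _ _)
  rw [flow_zero hb hper, intervalIntegral.integral_neg] at this
  linarith

/-- The derivatives of `y_x(-s) - x` with respect to `x` are `O(s)`, uniformly in `x`. -/
theorem exists_abs_iteratedDeriv_flow_sub_le {b : ℝ → ℝ} (hb : ContDiff ℝ 1 b)
    (hper : Function.Periodic b 1) {n : ℕ} (hn : ContDiff ℝ n b) {T : ℝ} (hT : 0 < T) :
    ∃ B, 0 ≤ B ∧ ∀ s, 0 < s → s ≤ T → ∀ x, ∀ j ≤ n,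
      |iteratedDeriv j (fun x => flow b s x - x) x| ≤ B * s := by
  have hG : JointlySmooth n fun s x => b (flow b s x) :=
    (jointlySmooth_flow hb hper hn).comp hn
  have hGper : ∀ r, Function.Periodic (fun x => b (flow b r x)) 1 := fun r x => by
    simp only [flow_add_one hb hper, hper _]
  -- Compactness bounds the derivatives for times in `[0, T]` and `x` in one period; periodicity in
  -- `x` makes the bound global.
  have hbd : ∀ j ∈ Finset.range (n + 1), ∃ B, 0 ≤ B ∧ ∀ r ∈ Icc 0 T, ∀ x,
      |iteratedDeriv j (fun x => b (flow b r x)) x| ≤ B := by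
    intro j hj
    obtain ⟨B, hB⟩ := (isCompact_Icc (a := (0 : ℝ)) (b := T)).prod
      (isCompact_Icc (a := (0 : ℝ)) (b := 1)) |>.exists_bound_of_continuousOn
        (hG.continuous_iteratedDeriv (j := j) (by simpa [Nat.lt_succ_iff] using hj)).continuousOn
    refine ⟨B, (norm_nonneg _).trans (hB (0, 0) (by simp [hT.le])), fun r hr x => ?_⟩
    obtain ⟨x', hx', h⟩ := (periodic_iteratedDeriv (hGper r) j).exists_mem_Ico₀ one_pos x
    rw [h]
    exact hB (r, x') ⟨hr, Ico_subset_Icc_self hx'⟩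
  choose! B hB0 hB using hbd
  refine ⟨∑ j ∈ Finset.range (n + 1), B j, Finset.sum_nonneg hB0, fun s hs hsT x j hj => ?_⟩
  have hj' : j ∈ Finset.range (n + 1) := by simpa [Nat.lt_succ_iff] using hj
  have : (fun x => flow b s x - x) = -fun x => ∫ r in (0 : ℝ)..s, b (flow b r x) := by
    funext x; simp [flow_eq_sub_integral hb hper s x]
  rw [this, iteratedDeriv_neg, abs_neg, hG.iteratedDeriv_integral hj]
  have h1 := intervalIntegral.norm_integral_le_of_norm_le_const (a := (0 : ℝ)) (b := s) (C := B j)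
    (f := fun r => iteratedDeriv j (fun x => b (flow b r x)) x) (fun r hr => by
      rw [uIoc_of_le hs.le] at hr
      exact hB j hj' r ⟨hr.1.le, hr.2.trans hsT⟩ x)
  rw [sub_zero, abs_of_pos hs] at h1
  exact h1.trans (mul_le_mul_of_nonneg_right (Finset.single_le_sum hB0 hj') hs.le)

end SLDG

/-! ### Polynomial inequalities and the Gauss rule on an interval -/

namespace SLDG

open Set Filter Topology MeasureTheory

theorem gaussQuad_eval {k : ℕ} {p : Polynomial ℝ} (hp : p.natDegree ≤ 2 * k + 1) {a c : ℝ}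
    (hac : a < c) : gaussQuad k a c (fun x => p.eval x) = ∫ x in a..c, p.eval x := by
  let L : Polynomial ℝ := Polynomial.C ((c - a) / 2) * Polynomial.X + Polynomial.C ((a + c) / 2)
  have hL : L.natDegree ≤ 1 := Polynomial.natDegree_linear_le
  have hLe : ∀ x, (p.comp L).eval x = p.eval ((c - a) / 2 * x + (a + c) / 2) := fun x => by
    simp [L]
  have h := (isGaussRule k).exact_of_natDegree_le (p.comp L)
    ((Polynomial.natDegree_comp_le).trans (by nlinarith))
  simp only [hLe] at h
  rw [intervalIntegral.integral_comp_mul_add (fun x => p.eval x) (by linarith : (c - a) / 2 ≠ 0)]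
    at h
  have e1 : (c - a) / 2 * -1 + (a + c) / 2 = a := by ring
  have e2 : (c - a) / 2 * 1 + (a + c) / 2 = c := by ring
  have hne : c - a ≠ 0 := by linarith
  rw [e1, e2, smul_eq_mul] at h
  have h' : ∫ x in a..c, p.eval x = (c - a) / 2 *
      ∑ α, gaussWeight k α * p.eval ((c - a) / 2 * gaussPoint k α + (a + c) / 2) := by
    rw [← h]; field_simp
  rw [h', gaussQuad, Finset.mul_sum]
  refine Finset.sum_congr rfl fun α _ => ?_
  have : a + (1 + gaussPoint k α) / 2 * (c - a) = (c - a) / 2 * gaussPoint k α + (a + c) / 2 := by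
    ring
  rw [this]; ring

theorem sum_gaussWeight (k : ℕ) : ∑ α, gaussWeight k α = 2 := by
  have h := (isGaussRule k).exact_of_natDegree_le 1 (by simp)
  simp at h
  linarith

theorem gaussQuad_sub (k : ℕ) (a c : ℝ) (f g : ℝ → ℝ) :
    gaussQuad k a c (fun x => f x - g x) = gaussQuad k a c f - gaussQuad k a c g := by
  simp only [gaussQuad, mul_sub, Finset.sum_sub_distrib]

theorem gaussQuad_node_mem (k : ℕ) {a c : ℝ} (hac : a < c) (α : Fin (k + 1)) :
    a + (1 + gaussPoint k α) / 2 * (c - a) ∈ Ioo a c := by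
  obtain ⟨h1, h2⟩ := (isGaussRule k).mem_Ioo α
  have : 0 < c - a := by linarith
  constructor <;> nlinarith

theorem gaussQuad_congr {k : ℕ} {a c : ℝ} (hac : a < c) {f g : ℝ → ℝ}
    (h : ∀ x ∈ Ioo a c, f x = g x) : gaussQuad k a c f = gaussQuad k a c g :=
  Finset.sum_congr rfl fun α _ => by rw [h _ (gaussQuad_node_mem k hac α)]

theorem abs_gaussQuad_le {k : ℕ} {a c B : ℝ} (hac : a < c) {f : ℝ → ℝ}
    (h : ∀ x ∈ Ioo a c, |f x| ≤ B) : |gaussQuad k a c f| ≤ B * (c - a) := by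
  have hw : ∀ α, 0 < gaussWeight k α := (isGaussRule k).weight_pos
  calc |gaussQuad k a c f| ≤ ∑ α, gaussWeight k α / 2 * (c - a) * B := by
        refine (Finset.abs_sum_le_sum_abs _ _).trans (Finset.sum_le_sum fun α _ => ?_)
        have : 0 ≤ gaussWeight k α / 2 * (c - a) := by
          have := hw α; have : 0 < c - a := by linarith
          positivity
        rw [abs_mul, abs_of_nonneg this]
        exact mul_le_mul_of_nonneg_left (h _ (gaussQuad_node_mem k hac α)) this
    _ = B * (c - a) := by
        rw [← Finset.sum_mul, ← Finset.sum_mul, ← Finset.sum_div, sum_gaussWeight]; ring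

/-- On polynomials of degree at most `k`, the `L²(0, 1)` norm controls the coefficients. -/
theorem exists_coeff_sq_le (k : ℕ) : ∃ m : ℝ, 0 < m ∧ ∀ p : Polynomial ℝ, p.natDegree ≤ k →
    ∀ j, m * p.coeff j ^ 2 ≤ ∫ x in (0 : ℝ)..1, p.eval x ^ 2 := by
  let N : (Fin (k + 1) → ℝ) → ℝ := fun v => ∫ x in (0 : ℝ)..1, (∑ i, v i * x ^ (i : ℕ)) ^ 2
  have hNc : Continuous N := by
    apply intervalIntegral.continuous_parametric_intervalIntegral_of_continuous'
    fun_prop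
  have hNs : ∀ (r : ℝ) v, N (r • v) = r ^ 2 * N v := fun r v => by
    simp only [N, ← intervalIntegral.integral_const_mul]
    congr 1; funext x
    rw [← mul_pow, Finset.mul_sum]
    simp [mul_assoc]
  have hNp : ∀ p : Polynomial ℝ, p.natDegree ≤ k →
      ∫ x in (0 : ℝ)..1, p.eval x ^ 2 = N fun i => p.coeff i := fun p hp => by
    simp only [N]
    congr 1; funext x
    rw [Polynomial.eval_eq_sum_range' (Nat.lt_succ_of_le hp), Finset.sum_range]
  have hpos : ∀ v, v ≠ 0 → 0 < N v := by
    intro v hv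
    let p : Polynomial ℝ := ∑ i, Polynomial.C (v i) * Polynomial.X ^ (i : ℕ)
    have hpe : ∀ x, p.eval x = ∑ i, v i * x ^ (i : ℕ) := fun x => by
      simp [p, Polynomial.eval_finsetSum]
    have hp : p ≠ 0 := by
      intro hp0
      apply hv
      funext i
      have : p.coeff i = v i := by
        simp only [p, Polynomial.finsetSum_coeff, Polynomial.coeff_C_mul, Polynomial.coeff_X_pow]
        rw [Finset.sum_eq_single i] <;> simp +contextual [Fin.ext_iff, eq_comm]
      rw [← this, hp0]; simp
    have hi : (Icc (0 : ℝ) 1).Infinite := Icc_infinite one_pos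
    obtain ⟨x, hx, hpx⟩ : ∃ x ∈ Icc (0 : ℝ) 1, p.eval x ≠ 0 := by
      by_contra! hz
      exact hp (p.eq_zero_of_infinite_isRoot (hi.mono hz))
    refine intervalIntegral.integral_pos one_pos (by fun_prop) (fun y _ => sq_nonneg _)
      ⟨x, hx, ?_⟩
    rw [← hpe]
    positivity
  -- `N` is continuous, positive away from zero and homogeneous of degree two, so its minimum on the
  -- unit sphere of the sup norm serves as `m`.
  have hne : (Metric.sphere (0 : Fin (k + 1) → ℝ) 1).Nonempty :=
    NormedSpace.sphere_nonempty.mpr zero_le_one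
  obtain ⟨v₀, hv₀, hmin⟩ := (isCompact_sphere (0 : Fin (k + 1) → ℝ) 1).exists_isMinOn hne
    hNc.continuousOn
  refine ⟨N v₀, hpos v₀ (Metric.ne_of_mem_sphere hv₀ one_ne_zero), fun p hp j => ?_⟩
  rw [hNp p hp]
  set v : Fin (k + 1) → ℝ := fun i => p.coeff i
  have hv0 : N v₀ * ‖v‖ ^ 2 ≤ N v := by
    rcases eq_or_ne v 0 with hv | hv
    · rw [hv]
      simp [N]
    · have hvn : ‖v‖ ≠ 0 := norm_ne_zero_iff.mpr hv
      have h1 : N v₀ ≤ N (‖v‖⁻¹ • v) := hmin (by simp [norm_smul, hvn])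
      rw [hNs, inv_pow] at h1
      have h2 : 0 < ‖v‖ ^ 2 := by positivity
      calc N v₀ * ‖v‖ ^ 2 ≤ ((‖v‖ ^ 2)⁻¹ * N v) * ‖v‖ ^ 2 := by gcongr
        _ = N v := by field_simp
  refine le_trans ?_ hv0
  have hN0 := hpos v₀ (Metric.ne_of_mem_sphere hv₀ one_ne_zero)
  gcongr ?_ * ?_
  rw [← sq_abs]
  gcongr
  by_cases hj : j < k + 1
  · exact norm_le_pi_norm v ⟨j, hj⟩
  · rw [Polynomial.coeff_eq_zero_of_natDegree_lt (by omega)]; simp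

/-- The polynomial `z ↦ p (a + h z)`. -/
noncomputable def rescale (p : Polynomial ℝ) (a h : ℝ) : Polynomial ℝ :=
  p.comp (Polynomial.C h * Polynomial.X + Polynomial.C a)

theorem eval_rescale (p : Polynomial ℝ) (a h z : ℝ) :
    (rescale p a h).eval z = p.eval (a + h * z) := by
  simp [rescale, add_comm]

theorem natDegree_rescale_le (p : Polynomial ℝ) (a h : ℝ) :
    (rescale p a h).natDegree ≤ p.natDegree := by
  refine Polynomial.natDegree_comp_le.trans ?_
  have : (Polynomial.C h * Polynomial.X + Polynomial.C a).natDegree ≤ 1 :=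
    Polynomial.natDegree_linear_le
  nlinarith

/-- The affine map from `(0, 1)` onto `(a, c)` reduces this to the unit interval; its Jacobian
accounts for the factor `√(c - a)`. -/
theorem exists_coeff_rescale_le (k : ℕ) : ∃ C : ℝ, 0 ≤ C ∧ ∀ p : Polynomial ℝ, p.natDegree ≤ k →
    ∀ a c, a < c → ∀ j, √(c - a) * |(rescale p a (c - a)).coeff j| ≤
      C * √(∫ x in a..c, p.eval x ^ 2) := by
  obtain ⟨m, hm, H⟩ := exists_coeff_sq_le k
  refine ⟨√m⁻¹, Real.sqrt_nonneg _, fun p hp a c hac j => ?_⟩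
  have hne : c - a ≠ 0 := by linarith
  have h := H _ ((natDegree_rescale_le p a (c - a)).trans hp) j
  simp only [eval_rescale] at h
  rw [intervalIntegral.integral_comp_add_mul (fun x => p.eval x ^ 2) hne] at h
  have e : a + (c - a) * 1 = c := by ring
  rw [e, mul_zero, add_zero, smul_eq_mul] at h
  rw [← Real.sqrt_sq_eq_abs, ← Real.sqrt_mul (by linarith), ← Real.sqrt_mul (by positivity)]
  apply Real.sqrt_le_sqrt
  have hpos : 0 < c - a := by linarith
  rw [inv_mul_eq_div, le_div_iff₀ hm]
  rw [inv_mul_eq_div, le_div_iff₀ hpos] at h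
  linarith

theorem abs_eval_le {k : ℕ} {q : Polynomial ℝ} (hq : q.natDegree ≤ k) {N R z : ℝ} (hR : 1 ≤ R)
    (hN : ∀ j, |q.coeff j| ≤ N) (hz : |z| ≤ R) : |q.eval z| ≤ (k + 1) * R ^ k * N := by
  have hN0 : 0 ≤ N := (abs_nonneg _).trans (hN 0)
  rw [Polynomial.eval_eq_sum_range' (Nat.lt_succ_of_le hq)]
  calc _ ≤ ∑ j ∈ Finset.range (k + 1), N * R ^ k := by
        refine (Finset.abs_sum_le_sum_abs _ _).trans (Finset.sum_le_sum fun j hj => ?_)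
        rw [abs_mul, abs_pow]
        have hj' : j ≤ k := by simpa [Nat.lt_succ_iff] using hj
        gcongr
        · exact hN j
        · exact (pow_le_pow_left₀ (abs_nonneg z) hz j).trans (pow_le_pow_right₀ hR hj')
    _ = _ := by simp; ring

/-- The remainders satisfy `r (j+1) = (z + e) r j + j z^(j-1) e²`, and `j² + j ≤ (j + 1)²` closes
the induction. -/
theorem abs_add_pow_sub_le {R z e : ℝ} (hR : 1 ≤ R) (hz : |z| ≤ R) (hze : |z + e| ≤ R) (j : ℕ) :
    |(z + e) ^ j - z ^ j - j * z ^ (j - 1) * e| ≤ j ^ 2 * R ^ j * e ^ 2 := by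
  induction j with
  | zero => simp
  | succ j ih =>
    have e1 : (z + e) ^ (j + 1) - z ^ (j + 1) - ((j + 1 : ℕ) : ℝ) * z ^ (j + 1 - 1) * e =
        (z + e) * ((z + e) ^ j - z ^ j - j * z ^ (j - 1) * e) + j * z ^ (j - 1) * e ^ 2 := by
      cases j with
      | zero => simp
      | succ i => push_cast; ring
    rw [e1]
    have h0 : (0 : ℝ) ≤ R := by linarith
    have h1 : |z| ^ (j - 1) ≤ R ^ (j + 1) :=
      (pow_le_pow_left₀ (abs_nonneg z) hz _).trans (pow_le_pow_right₀ hR (by omega))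
    calc _ ≤ |z + e| * |(z + e) ^ j - z ^ j - j * z ^ (j - 1) * e| +
          j * |z| ^ (j - 1) * e ^ 2 := by
          refine (abs_add_le _ _).trans (le_of_eq ?_)
          simp only [abs_mul, abs_pow, Nat.abs_cast, sq_abs]
      _ ≤ R * (j ^ 2 * R ^ j * e ^ 2) + j * R ^ (j + 1) * e ^ 2 := by gcongr
      _ = (j ^ 2 + j) * (R ^ (j + 1) * e ^ 2) := by ring
      _ ≤ (j + 1) ^ 2 * (R ^ (j + 1) * e ^ 2) := by
          gcongr; nlinarith [Nat.cast_nonneg (α := ℝ) j]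
      _ = _ := by push_cast; ring

/-- Second order Taylor estimate for a polynomial, in terms of its coefficients. -/
theorem abs_eval_add_sub_le {k : ℕ} {q : Polynomial ℝ} (hq : q.natDegree ≤ k) {N R z e : ℝ}
    (hR : 1 ≤ R) (hN : ∀ j, |q.coeff j| ≤ N) (hz : |z| ≤ R) (hze : |z + e| ≤ R) :
    |q.eval (z + e) - q.eval z - q.derivative.eval z * e| ≤ (k + 1) ^ 3 * R ^ k * N * e ^ 2 := by
  have hN0 : 0 ≤ N := (abs_nonneg _).trans (hN 0)
  have hd : q.derivative.eval z =
      ∑ j ∈ Finset.range (k + 1), q.coeff j * (j * z ^ (j - 1)) := by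
    conv_lhs => rw [q.as_sum_range' (k + 1) (Nat.lt_succ_of_le hq)]
    simp [Polynomial.eval_finsetSum, Polynomial.derivative_monomial, mul_assoc]
  rw [hd, Polynomial.eval_eq_sum_range' (Nat.lt_succ_of_le hq),
    Polynomial.eval_eq_sum_range' (Nat.lt_succ_of_le hq), Finset.sum_mul, ← Finset.sum_sub_distrib,
    ← Finset.sum_sub_distrib]
  calc _ ≤ ∑ j ∈ Finset.range (k + 1), N * ((k + 1) ^ 2 * R ^ k * e ^ 2) := by
        refine (Finset.abs_sum_le_sum_abs _ _).trans (Finset.sum_le_sum fun j hj => ?_)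
        have hj' : j ≤ k := by simpa [Nat.lt_succ_iff] using hj
        have e1 : q.coeff j * (z + e) ^ j - q.coeff j * z ^ j - q.coeff j * (j * z ^ (j - 1)) * e =
            q.coeff j * ((z + e) ^ j - z ^ j - j * z ^ (j - 1) * e) := by ring
        rw [e1, abs_mul]
        have h0 : (0 : ℝ) ≤ R := by linarith
        have hjk : (j : ℝ) ≤ k + 1 := by exact_mod_cast (by omega : j ≤ k + 1)
        have hjR : R ^ j ≤ R ^ k := pow_le_pow_right₀ hR hj'
        gcongr
        · exact hN j
        · exact (abs_add_pow_sub_le hR hz hze j).trans (by gcongr)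
    _ = _ := by simp; ring

/-- On polynomials of degree at most `k`, the `L²` norm controls the supremum norm. -/
theorem exists_sqrt_mul_abs_eval_le (k : ℕ) : ∃ C : ℝ, 0 ≤ C ∧ ∀ p : Polynomial ℝ,
    p.natDegree ≤ k → ∀ a c, a < c → ∀ x ∈ Icc a c, √(c - a) * |p.eval x| ≤
      C * √(∫ x in a..c, p.eval x ^ 2) := by
  obtain ⟨C, hC, H⟩ := exists_coeff_rescale_le k
  refine ⟨(k + 1) * C, by positivity, fun p hp a c hac x hx => ?_⟩
  have hpos : 0 < c - a := by linarith
  have hs : 0 < √(c - a) := Real.sqrt_pos.mpr hpos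
  set F := √(∫ x in a..c, p.eval x ^ 2)
  have hN : ∀ j, |(rescale p a (c - a)).coeff j| ≤ C * F / √(c - a) := fun j => by
    rw [le_div_iff₀ hs, mul_comm]; exact H p hp a c hac j
  have h1 := abs_eval_le ((natDegree_rescale_le p a (c - a)).trans hp) le_rfl hN
    (z := (x - a) / (c - a)) (by
      rw [abs_of_nonneg (div_nonneg (by linarith [hx.1]) hpos.le), div_le_one hpos]
      linarith [hx.2])
  rw [eval_rescale, mul_div_cancel₀ _ hpos.ne', add_sub_cancel, one_pow, mul_one] at h1
  calc √(c - a) * |p.eval x| ≤ √(c - a) * ((k + 1) * (C * F / √(c - a))) := by gcongr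
    _ = _ := by field_simp

/-- Error of the Gauss rule for `f φ`, where `f` is close to a polynomial of degree `k + 1`. -/
theorem exists_gaussQuad_error_le (k : ℕ) : ∃ C : ℝ, 0 ≤ C ∧ ∀ (P φ : Polynomial ℝ),
    P.natDegree ≤ k + 1 → φ.natDegree ≤ k → ∀ (f : ℝ → ℝ) (a c ε : ℝ), a < c →
    IntervalIntegrable (fun x => f x * φ.eval x) volume a c →
    (∀ x ∈ Ioo a c, |f x - P.eval x| ≤ ε) →
    |gaussQuad k a c (fun x => f x * φ.eval x) - ∫ x in a..c, f x * φ.eval x| ≤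
      C * (ε * √(c - a) * √(∫ x in a..c, φ.eval x ^ 2)) := by
  obtain ⟨C, hC, H⟩ := exists_sqrt_mul_abs_eval_le k
  refine ⟨2 * C, by positivity, fun P φ hP hφ f a c ε hac hint hf => ?_⟩
  have hpos : 0 < c - a := by linarith
  have hs : 0 < √(c - a) := Real.sqrt_pos.mpr hpos
  set F := √(∫ x in a..c, φ.eval x ^ 2)
  have hε : 0 ≤ ε := (abs_nonneg _).trans (hf ((a + c) / 2) ⟨by linarith, by linarith⟩)
  have hsup : ∀ x ∈ Ioo a c, |φ.eval x| ≤ C * F / √(c - a) := by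
    intro x hx
    rw [le_div_iff₀ hs, mul_comm]
    exact H φ hφ a c hac x (Ioo_subset_Icc_self hx)
  set S := C * F / √(c - a)
  have hg : ∀ x ∈ Ioo a c, |f x * φ.eval x - (P * φ).eval x| ≤ ε * S := by
    intro x hx
    rw [Polynomial.eval_mul, ← sub_mul, abs_mul]
    exact mul_le_mul (hf x hx) (hsup x hx) (abs_nonneg _) hε
  -- Exactness on `P φ` leaves only `(f - P) φ`. Its quadrature and its integral are each at most `ε
  -- S (c - a)`, hence the factor 2 in the constant.
  have hdeg : (P * φ).natDegree ≤ 2 * k + 1 := Polynomial.natDegree_mul_le.trans (by omega)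
  have hPi : IntervalIntegrable (fun x => (P * φ).eval x) volume a c :=
    (P * φ).continuous.intervalIntegrable _ _
  have h1 := abs_gaussQuad_le (k := k) hac hg
  have h2 : |∫ x in a..c, (f x * φ.eval x - (P * φ).eval x)| ≤ ε * S * (c - a) := by
    have h := intervalIntegral.norm_integral_le_of_norm_le_const_ae (a := a) (b := c) (C := ε * S)
      (f := fun x => f x * φ.eval x - (P * φ).eval x) (by
        filter_upwards [compl_mem_ae_iff.mpr (measure_singleton c)] with x hxc hx
        rw [uIoc_of_le hac.le] at hx
        exact hg x ⟨hx.1, lt_of_le_of_ne hx.2 hxc⟩)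
    rwa [abs_of_pos hpos] at h
  rw [gaussQuad_sub, gaussQuad_eval hdeg hac] at h1
  rw [intervalIntegral.integral_sub hint hPi] at h2
  have h3 : ε * S * (c - a) = C * (ε * √(c - a) * F) := by
    have : c - a = √(c - a) * √(c - a) := (Real.mul_self_sqrt hpos.le).symm
    calc ε * S * (c - a) = ε * S * (√(c - a) * √(c - a)) := by rw [← this]
      _ = _ := by simp only [S]; field_simp
  rw [h3] at h1 h2
  rw [abs_le] at h1 h2 ⊢
  constructor <;> linarith [h1.1, h1.2, h2.1, h2.2]

end SLDG

/-! ### Approximation by polynomials -/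

namespace SLDG

open Set Filter Topology MeasureTheory

theorem taylor_lagrange {f : ℝ → ℝ} {x₀ x : ℝ} {n : ℕ} (hx : x₀ ≠ x)
    (hf : ContDiffOn ℝ (n + 1 : ℕ) f (uIcc x₀ x)) (hf₀ : ContDiffAt ℝ n f x₀) :
    ∃ x' ∈ uIoo x₀ x,
      f x - ∑ i ∈ Finset.range (n + 1), iteratedDeriv i f x₀ / i.factorial * (x - x₀) ^ i =
        iteratedDeriv (n + 1) f x' * (x - x₀) ^ (n + 1) / (n + 1).factorial := by
  obtain ⟨x', hx', h⟩ := taylor_mean_remainder_lagrange_iteratedDeriv hx (by exact_mod_cast hf)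
  refine ⟨x', hx', ?_⟩
  rw [← h, taylor_within_apply]
  congr 1
  refine Finset.sum_congr rfl fun i hi => ?_
  have hi' : (i : WithTop ℕ∞) ≤ n := by
    exact_mod_cast (by simpa [Nat.lt_succ_iff] using hi : i ≤ n)
  rw [iteratedDerivWithin_eq_iteratedDeriv (uniqueDiffOn_uIcc hx) (hf₀.of_le hi') left_mem_uIcc,
    smul_eq_mul]
  ring

/-- Taylor's formula at the midpoint. As this point is interior, ordinary derivatives can be used
although `f` may be smooth only on the closed interval, as in statement (iii). -/
theorem exists_polynomial_approx {k : ℕ} {f : ℝ → ℝ} {a c D : ℝ} (hac : a < c)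
    (hf : ContDiffOn ℝ (k + 1 : ℕ) f (Icc a c))
    (hD : ∀ x ∈ Ioo a c, |iteratedDeriv (k + 1) f x| ≤ D) :
    ∃ P : Polynomial ℝ, P.natDegree ≤ k ∧
      ∀ x ∈ Icc a c, |f x - P.eval x| ≤ D * (c - a) ^ (k + 1) := by
  set m := (a + c) / 2 with hm
  have hma : m ∈ Ioo a c := ⟨by linarith, by linarith⟩
  have hD0 : 0 ≤ D := (abs_nonneg _).trans (hD m hma)
  let P : Polynomial ℝ := ∑ i ∈ Finset.range (k + 1),
    Polynomial.C (iteratedDeriv i f m / i.factorial) * (Polynomial.X - Polynomial.C m) ^ i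
  have hPe : ∀ x, P.eval x =
      ∑ i ∈ Finset.range (k + 1), iteratedDeriv i f m / i.factorial * (x - m) ^ i := fun x => by
    simp [P, Polynomial.eval_finsetSum]
  refine ⟨P, Polynomial.natDegree_sum_le_of_forall_le _ _ fun i hi => ?_, fun x hx => ?_⟩
  · refine (Polynomial.natDegree_C_mul_le _ _).trans ?_
    rw [Polynomial.natDegree_pow, Polynomial.natDegree_X_sub_C]
    simpa [Nat.lt_succ_iff] using hi
  · have hnn : 0 ≤ D * (c - a) ^ (k + 1) := mul_nonneg hD0 (pow_nonneg (by linarith) _)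
    rcases eq_or_ne m x with rfl | hne
    · have : P.eval m = f m := by
        rw [hPe, Finset.sum_range_succ', Finset.sum_eq_zero (by simp)]
        simp
      rw [this]; simpa using hnn
    · have hsub : uIcc m x ⊆ Icc a c := uIcc_subset_Icc (Ioo_subset_Icc_self hma) hx
      have hat : ContDiffAt ℝ k f m :=
        (hf.contDiffAt (Icc_mem_nhds hma.1 hma.2)).of_le (by exact_mod_cast Nat.le_succ k)
      obtain ⟨x', hx', h⟩ := taylor_lagrange hne (hf.mono hsub) hat
      rw [hPe, h, abs_div, abs_mul, abs_pow, Nat.abs_cast]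
      have hx'' : x' ∈ Ioo a c :=
        ⟨(le_min hma.1.le hx.1).trans_lt hx'.1, hx'.2.trans_le (max_le hma.2.le hx.2)⟩
      have h1 : |x - m| ≤ c - a := by
        rw [abs_le]; constructor <;> linarith [hx.1, hx.2, hma.1, hma.2]
      have h2 : (1 : ℝ) ≤ (k + 1).factorial := by
        exact_mod_cast Nat.factorial_pos (k + 1)
      calc _ ≤ |iteratedDeriv (k + 1) f x'| * |x - m| ^ (k + 1) := div_le_self (by positivity) h2
        _ ≤ _ := by gcongr; exact hD x' hx''

/-- Two-sided Lipschitz bounds for `x ↦ y_x(-s)`, uniform in `s ∈ (0, T]`. -/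
theorem exists_flow_bilipschitz {b : ℝ → ℝ} (hb : ContDiff ℝ 1 b) (hper : Function.Periodic b 1)
    {T : ℝ} (hT : 0 < T) : ∃ L, 1 ≤ L ∧ ∀ s, 0 < s → s ≤ T → ∀ a c, a < c →
      c - a ≤ L * (flow b s c - flow b s a) := by
  obtain ⟨K, hK0, hK⟩ := exists_bound_of_periodic (hb.continuous_deriv le_rfl) (periodic_deriv hper)
  refine ⟨Real.exp (K * T), Real.one_le_exp (by positivity), fun s hs hsT a c hac => ?_⟩
  -- The factor by which the flow stretches is at least `exp (-K s)`, where `K` bounds `|b'|`; `exp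
  -- (K T)` compensates for it.
  rw [flow_sub hb hper, mul_left_comm, ← Real.exp_add]
  refine le_mul_of_one_le_right (by linarith) (Real.one_le_exp ?_)
  have := intervalIntegral.norm_integral_le_of_norm_le_const (a := (0 : ℝ)) (b := s) (C := K)
    (f := fun r => meanSlope b (flow b r a) (flow b r c)) (fun r _ => abs_meanSlope_le hK _ _)
  rw [sub_zero, abs_of_pos hs, Real.norm_eq_abs] at this
  have h1 := (le_abs_self _).trans this
  have h2 : K * s ≤ K * T := by gcongr
  linarith

/-- Second order expansion of `x ↦ y_x(-s)`. -/
theorem exists_flow_expansion {b : ℝ → ℝ} (hb : ContDiff ℝ 3 b) (hper : Function.Periodic b 1)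
    {T : ℝ} (hT : 0 < T) : ∃ B, 0 ≤ B ∧ ∀ s, 0 < s → s ≤ T → ∀ a, ∃ α β, |α| ≤ 1 + B * s ∧
      |β| ≤ B * s ∧ ∀ x, a ≤ x →
      |flow b s x - flow b s a - α * (x - a) - β * (x - a) ^ 2| ≤ B * s * (x - a) ^ 3 := by
  have hb1 : ContDiff ℝ 1 b := hb.of_le (by norm_num)
  have hb3 : ContDiff ℝ (3 : ℕ) b := by exact_mod_cast hb
  obtain ⟨B, hB0, hB⟩ := exists_abs_iteratedDeriv_flow_sub_le hb1 hper hb3 hT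
  refine ⟨B, hB0, fun s hs hsT a => ?_⟩
  set g : ℝ → ℝ := fun x => flow b s x - x with hg
  have hgc : ContDiff ℝ (3 : ℕ) g := ((jointlySmooth_flow hb1 hper hb3).contDiff s).sub contDiff_id
  have hBs : 0 ≤ B * s := by positivity
  -- These are the Taylor coefficients at `a` of `id + g`. All derivatives of `g` up to order three
  -- are at most `B s`, so every term beyond the identity carries a factor `s`.
  refine ⟨1 + iteratedDeriv 1 g a, iteratedDeriv 2 g a / 2, ?_, ?_, fun x hx => ?_⟩
  · refine (abs_add_le _ _).trans ?_
    rw [abs_one]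
    have := hB s hs hsT a 1 (by norm_num)
    linarith
  · rw [abs_div, abs_two]
    have := hB s hs hsT a 2 (by norm_num)
    linarith
  · rcases hx.eq_or_lt with rfl | hx
    · simp
    obtain ⟨x', hx', h⟩ := taylor_lagrange (n := 2) hx.ne hgc.contDiffOn
      (hgc.contDiffAt.of_le (by norm_num))
    have e : flow b s x - flow b s a - (1 + iteratedDeriv 1 g a) * (x - a) -
        iteratedDeriv 2 g a / 2 * (x - a) ^ 2 =
        iteratedDeriv 3 g x' * (x - a) ^ 3 / (2 + 1).factorial := by
      rw [← h]
      simp [Finset.sum_range_succ, hg]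
      ring
    have hp : 0 < x - a := by linarith
    rw [e, abs_div, abs_mul, abs_pow, abs_of_pos hp, Nat.abs_cast]
    refine (div_le_self (by positivity) (by norm_num [Nat.factorial])).trans ?_
    gcongr
    exact hB s hs hsT x' 3 le_rfl

/-! ### Polynomials composed with the flow. -/

theorem coeff_rescale_mul (p : Polynomial ℝ) (a l r : ℝ) (j : ℕ) :
    (rescale p a (l * r)).coeff j = (rescale p a l).coeff j * r ^ j := by
  rw [← Polynomial.comp_C_mul_X_coeff]
  congr 1
  refine Polynomial.funext fun z => ?_
  simp [eval_rescale, mul_assoc]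

/-- The norm lives on the image interval, of length `l`, but the expansion of the flow is scaled by
`c - a`. Since `(c - a) / l ≤ L`, changing the scale costs at most `L^k` in a coefficient and one
further `L` in the factor `√(c - a)`. -/
theorem exists_coeff_rescale_flow_le (k : ℕ) {b : ℝ → ℝ} (hb : ContDiff ℝ 1 b)
    (hper : Function.Periodic b 1) {T : ℝ} (hT : 0 < T) : ∃ C, 0 ≤ C ∧ ∀ s, 0 < s → s ≤ T →
      ∀ a c, a < c → ∀ p : Polynomial ℝ, p.natDegree ≤ k → ∀ j,
      √(c - a) * |(rescale p (flow b s a) (c - a)).coeff j| ≤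
        C * √(∫ y in flow b s a..flow b s c, p.eval y ^ 2) := by
  obtain ⟨L, hL, hLip⟩ := exists_flow_bilipschitz hb hper hT
  obtain ⟨C, hC, H⟩ := exists_coeff_rescale_le k
  refine ⟨L ^ (k + 1) * C, by positivity, fun s hs hsT a c hac p hp j => ?_⟩
  set A := flow b s a
  set l := flow b s c - A with hl
  have hl0 : 0 < l := sub_pos.mpr (flow_strictMono hb hper s hac)
  have hpos : 0 < c - a := by linarith
  have hr : (c - a) / l ≤ L := by rw [div_le_iff₀ hl0]; exact hLip s hs hsT a c hac
  have hr0 : 0 ≤ (c - a) / l := by positivity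
  have e : c - a = l * ((c - a) / l) := by field_simp
  by_cases hj : j ≤ k
  · have h := H p hp A _ (flow_strictMono hb hper s hac) j
    rw [← hl] at h
    have h1 : √(c - a) ≤ L * √l := by
      rw [Real.sqrt_le_left (by positivity), mul_pow, Real.sq_sqrt hl0.le]
      have := hLip s hs hsT a c hac
      rw [← hl] at this
      nlinarith
    have h2 : |(rescale p A (c - a)).coeff j| ≤ L ^ k * |(rescale p A l).coeff j| := by
      conv_lhs => rw [e, coeff_rescale_mul, abs_mul, abs_pow, abs_of_nonneg hr0, mul_comm]
      gcongr
      exact (pow_le_pow_left₀ hr0 hr j).trans (pow_le_pow_right₀ hL hj)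
    calc _ ≤ (L * √l) * (L ^ k * |(rescale p A l).coeff j|) := by gcongr
      _ = L ^ (k + 1) * (√l * |(rescale p A l).coeff j|) := by ring
      _ ≤ L ^ (k + 1) * (C * _) := by gcongr
      _ = _ := by ring
  · rw [Polynomial.coeff_eq_zero_of_natDegree_lt
      (((natDegree_rescale_le p A (c - a)).trans hp).trans_lt (not_le.mp hj))]
    simp only [abs_zero, mul_zero]
    positivity

/-- `p ∘ y_·(-s)` is close to a polynomial of degree `k + 1`. -/
theorem exists_comp_flow_approx (k : ℕ) {b : ℝ → ℝ} (hb : ContDiff ℝ (2 * k + 2 : ℕ) b)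
    (hper : Function.Periodic b 1) {T : ℝ} (hT : 0 < T) : ∃ C, 0 ≤ C ∧ ∀ s, 0 < s → s ≤ T →
      ∀ a c, a < c → c ≤ a + 1 → ∀ p : Polynomial ℝ, p.natDegree ≤ k →
      ∃ P : Polynomial ℝ, P.natDegree ≤ k + 1 ∧ ∀ x ∈ Icc a c,
      √(c - a) * |p.eval (flow b s x) - P.eval x| ≤
        C * s * (c - a) ^ 2 * √(∫ y in flow b s a..flow b s c, p.eval y ^ 2) := by
  -- For `k = 0` the composition is constant and there is no error. For `k ≥ 1` the hypothesis gives
  -- at least four derivatives of `b`, of which three are used.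
  rcases Nat.eq_zero_or_pos k with rfl | hk
  · refine ⟨0, le_rfl, fun s hs hsT a c hac _ p hp => ⟨p, by omega, fun x hx => ?_⟩⟩
    rw [Polynomial.eq_C_of_natDegree_le_zero hp]
    simp
  have hb1 : ContDiff ℝ 1 b := hb.of_le (by exact_mod_cast (by omega : 1 ≤ 2 * k + 2))
  have hb3 : ContDiff ℝ 3 b := hb.of_le (by exact_mod_cast (by omega : 3 ≤ 2 * k + 2))
  obtain ⟨B, hB, hexp⟩ := exists_flow_expansion hb3 hper hT
  obtain ⟨C, hC, H⟩ := exists_coeff_rescale_flow_le k hb1 hper hT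
  -- `R` bounds both arguments of `q` below: `|α t| ≤ 1 + B T` and `|e| ≤ 2 B T`.
  set R := 1 + 3 * (B * T) with hR
  have hR1 : 1 ≤ R := by rw [hR]; nlinarith [mul_nonneg hB hT.le]
  refine ⟨((k + 1) ^ 3 * R ^ k * (4 * B ^ 2 * T) + (k + 1) * R ^ k * ((k + 1) * B)) * C,
    by positivity, fun s hs hsT a c hac hca p hp => ?_⟩
  obtain ⟨α, β, hα, hβ, hY⟩ := hexp s hs hsT a
  set h := c - a with hh
  have hpos : 0 < h := by linarith
  have hh1 : h ≤ 1 := by linarith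
  have hsq : 0 < √h := Real.sqrt_pos.mpr hpos
  set F := √(∫ y in flow b s a..flow b s c, p.eval y ^ 2)
  set q := rescale p (flow b s a) h with hq
  have hqd : q.natDegree ≤ k := (natDegree_rescale_le _ _ _).trans hp
  set N := C * F / √h with hN
  have hN0 : 0 ≤ N := by positivity
  have hqN : ∀ j, |q.coeff j| ≤ N := fun j => by
    rw [hN, le_div_iff₀ hsq, mul_comm]; exact H s hs hsT a c hac p hp j
  have hdN : ∀ j, |q.derivative.coeff j| ≤ (k + 1) * N := fun j => by
    rw [Polynomial.coeff_derivative, abs_mul, mul_comm]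
    by_cases hj : j + 1 ≤ k
    · have : |(j : ℝ) + 1| ≤ k + 1 := by
        rw [abs_of_nonneg (by positivity)]
        have : ((j + 1 : ℕ) : ℝ) ≤ k := by exact_mod_cast hj
        push_cast at this; linarith
      gcongr
      exact hqN _
    · rw [Polynomial.coeff_eq_zero_of_natDegree_lt (by omega)]
      simp only [abs_zero, mul_zero]; positivity
  have hdd : q.derivative.natDegree ≤ k - 1 :=
    (Polynomial.natDegree_derivative_le q).trans (Nat.sub_le_sub_right hqd 1)
  -- The part of the expansion of `q` about `α t` that the Gauss rule absorbs. In the second summand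
  -- the degree is at most `(k - 1) + 2 = k + 1`; a cubic term of the flow would exceed this.
  let S : Polynomial ℝ := q.comp (Polynomial.C α * Polynomial.X) +
    q.derivative.comp (Polynomial.C α * Polynomial.X) *
      (Polynomial.C (β * h) * Polynomial.X ^ 2)
  have hlin : (Polynomial.C α * Polynomial.X : Polynomial ℝ).natDegree ≤ 1 :=
    (Polynomial.natDegree_C_mul_le α _).trans Polynomial.natDegree_X_le
  have hS : S.natDegree ≤ k + 1 := by
    refine Polynomial.natDegree_add_le_of_degree_le ?_ ?_
    · refine Polynomial.natDegree_comp_le.trans ?_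
      nlinarith
    · refine Polynomial.natDegree_mul_le.trans ?_
      have h1 := Polynomial.natDegree_C_mul_X_pow_le (β * h) 2
      have h2 : (q.derivative.comp (Polynomial.C α * Polynomial.X)).natDegree ≤ k - 1 := by
        refine Polynomial.natDegree_comp_le.trans ?_
        nlinarith
      omega
  -- This is the polynomial `x ↦ S ((x - a) / h)`.
  refine ⟨rescale S (-a / h) h⁻¹, (natDegree_rescale_le _ _ _).trans hS, fun x hx => ?_⟩
  set t := (x - a) / h with ht
  have ht0 : 0 ≤ t := div_nonneg (by linarith [hx.1]) hpos.le
  have ht1 : t ≤ 1 := by rw [ht, div_le_one hpos]; linarith [hx.2]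
  have hxt : x - a = h * t := by rw [ht]; field_simp
  have hPe : (rescale S (-a / h) h⁻¹).eval x =
      q.eval (α * t) + q.derivative.eval (α * t) * (β * h * t ^ 2) := by
    rw [eval_rescale, show -a / h + h⁻¹ * x = t by rw [ht]; field_simp; ring]
    simp [S]
  -- The deviation of the rescaled flow from its linear part: it is `O(s h)`, and `O(s h²)` once `β
  -- h t²` is removed.
  set e := (flow b s x - flow b s a) / h - α * t with he
  have hz : p.eval (flow b s x) = q.eval (α * t + e) := by
    rw [hq, eval_rescale, he]
    congr 1; field_simp; ring
  have hBs : 0 ≤ B * s := by positivity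
  have hBsT : B * s ≤ B * T := by gcongr
  have hρ : |e - β * h * t ^ 2| ≤ B * s * h ^ 2 := by
    have h1 := hY x hx.1
    rw [hxt] at h1
    have e1 : flow b s x - flow b s a - α * (h * t) - β * (h * t) ^ 2 =
        h * (e - β * h * t ^ 2) := by rw [he]; field_simp
    rw [e1, abs_mul, abs_of_pos hpos] at h1
    have h2 : h * |e - β * h * t ^ 2| ≤ h * (B * s * h ^ 2) := by
      refine h1.trans ?_
      calc B * s * (h * t) ^ 3 ≤ B * s * (h * 1) ^ 3 := by gcongr
        _ = _ := by ring
    exact le_of_mul_le_mul_left h2 hpos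
  have hβt : |β * h * t ^ 2| ≤ B * s * h := by
    rw [abs_mul, abs_mul, abs_of_pos hpos, abs_of_nonneg (by positivity : 0 ≤ t ^ 2)]
    calc _ ≤ B * s * h * 1 := by gcongr; exact pow_le_one₀ ht0 ht1
      _ = _ := by ring
  have heb : |e| ≤ 2 * (B * s * h) := by
    have h1 : |e| ≤ |e - β * h * t ^ 2| + |β * h * t ^ 2| := by
      have h2 := abs_add_le (e - β * h * t ^ 2) (β * h * t ^ 2)
      have h3 : e - β * h * t ^ 2 + β * h * t ^ 2 = e := by ring
      rwa [h3] at h2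
    have h2 : B * s * h ^ 2 ≤ B * s * h := by
      gcongr; nlinarith
    linarith
  have hαt : |α * t| ≤ 1 + B * T := by
    rw [abs_mul, abs_of_nonneg ht0]
    calc |α| * t ≤ (1 + B * s) * 1 := by gcongr
      _ ≤ _ := by linarith
  have heT : |e| ≤ 2 * (B * T) := heb.trans (by
    have : B * s * h ≤ B * s * 1 := by gcongr
    linarith)
  have hzR : |α * t| ≤ R := by rw [hR]; linarith [abs_nonneg e]
  have hzeR : |α * t + e| ≤ R := (abs_add_le _ _).trans (by rw [hR]; linarith)
  have key1 := abs_eval_add_sub_le hqd hR1 hqN hzR hzeR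
  have key2 := abs_eval_le (hdd.trans (Nat.sub_le k 1)) hR1 hdN hzR
  -- The quadratic remainder is of order `s² h²`; one factor `s` is traded for `T`.
  have he2 : e ^ 2 ≤ 4 * B ^ 2 * T * (s * h ^ 2) := by
    rw [← sq_abs]
    calc |e| ^ 2 ≤ (2 * (B * s * h)) ^ 2 := by gcongr
      _ = 4 * B ^ 2 * s * (s * h ^ 2) := by ring
      _ ≤ _ := by gcongr
  have hmain : |p.eval (flow b s x) - (rescale S (-a / h) h⁻¹).eval x| ≤
      ((k + 1) ^ 3 * R ^ k * (4 * B ^ 2 * T) + (k + 1) * R ^ k * ((k + 1) * B)) *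
        (s * h ^ 2) * N := by
    rw [hPe, hz]
    have e1 : q.eval (α * t + e) - (q.eval (α * t) +
        q.derivative.eval (α * t) * (β * h * t ^ 2)) =
        (q.eval (α * t + e) - q.eval (α * t) - q.derivative.eval (α * t) * e) +
          q.derivative.eval (α * t) * (e - β * h * t ^ 2) := by ring
    rw [e1]
    refine (abs_add_le _ _).trans ?_
    rw [abs_mul]
    calc _ ≤ (k + 1) ^ 3 * R ^ k * N * (4 * B ^ 2 * T * (s * h ^ 2)) +
          (k + 1) * R ^ k * ((k + 1) * N) * (B * s * h ^ 2) := by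
          gcongr
          exact key1.trans (by gcongr)
      _ = _ := by ring
  calc _ ≤ √h * (((k + 1) ^ 3 * R ^ k * (4 * B ^ 2 * T) + (k + 1) * R ^ k * ((k + 1) * B)) *
        (s * h ^ 2) * N) := by gcongr
    _ = _ := by rw [hN]; field_simp

/-- Quadrature error on one interval for `(p - ψ) ∘ y_·(-s)`. The constant in front of the
approximation error `μ` of `ψ` depends only on `k`. -/
theorem exists_interval_error_le (k : ℕ) : ∃ C₀ : ℝ, 0 ≤ C₀ ∧ ∀ b : ℝ → ℝ,
    ContDiff ℝ (2 * k + 2 : ℕ) b → Function.Periodic b 1 → ∀ T : ℝ, 0 < T → ∃ C : ℝ, 0 ≤ C ∧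
    ∀ s, 0 < s → s ≤ T → ∀ a c, a < c → c ≤ a + 1 →
    ∀ p φ Q : Polynomial ℝ, p.natDegree ≤ k → φ.natDegree ≤ k → Q.natDegree ≤ k →
    ∀ (ψ : ℝ → ℝ) (μ : ℝ), Continuous ψ →
    (∀ y ∈ Icc (flow b s a) (flow b s c), |ψ y - Q.eval y| ≤ μ) →
    |gaussQuad k a c (fun x => (p.eval (flow b s x) - ψ (flow b s x)) * φ.eval x) -
        ∫ x in a..c, (p.eval (flow b s x) - ψ (flow b s x)) * φ.eval x| ≤
      (C * s * (c - a) ^ 2 * √(∫ y in flow b s a..flow b s c, (p.eval y - ψ y) ^ 2) +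
        C₀ * μ * (√(c - a) + √(flow b s c - flow b s a))) *
          √(∫ x in a..c, φ.eval x ^ 2) := by
  obtain ⟨Cg, hCg, Hg⟩ := exists_gaussQuad_error_le k
  obtain ⟨C₃, hC₃, H₃⟩ := exists_sqrt_mul_abs_eval_le k
  refine ⟨Cg * (2 + 2 * C₃), by positivity, fun b hb hper T hT => ?_⟩
  have hb1 : ContDiff ℝ 1 b := hb.of_le (by exact_mod_cast (by omega : 1 ≤ 2 * k + 2))
  obtain ⟨C₂, hC₂, H₂⟩ := exists_comp_flow_approx k hb hper hT
  obtain ⟨L, hL, hLip⟩ := exists_flow_bilipschitz hb1 hper hT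
  refine ⟨Cg * (2 + 2 * C₃ * L) * C₂, by positivity,
    fun s hs hsT a c hac hca p φ Q hp hφ hQ ψ μ hψ hμ => ?_⟩
  have hmono := flow_strictMono hb1 hper s
  have hYc : Continuous (flow b s) :=
    (continuous_flow hb1 hper).comp (continuous_const.prodMk continuous_id)
  have hac' := hmono hac
  set h := c - a with hh
  set l := flow b s c - flow b s a with hl
  have hpos : 0 < h := by linarith
  have hlpos : 0 < l := by linarith
  have hsq : 0 < √h := Real.sqrt_pos.mpr hpos
  have hsl : 0 < √l := Real.sqrt_pos.mpr hlpos
  set W := √(∫ y in flow b s a..flow b s c, (p.eval y - ψ y) ^ 2) with hW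
  set F := √(∫ x in a..c, φ.eval x ^ 2)
  have hμ0 : 0 ≤ μ := (abs_nonneg _).trans (hμ _ (left_mem_Icc.mpr hac'.le))
  set r := p - Q with hr
  have hrd : r.natDegree ≤ k := (Polynomial.natDegree_sub_le _ _).trans (max_le hp hQ)
  set V := √(∫ y in flow b s a..flow b s c, r.eval y ^ 2) with hV
  -- From `(p - Q)² ≤ 2 (p - ψ)² + 2 μ²`, integrated over the image interval of length `l`.
  have hVW : V ≤ 2 * (W + μ * √l) := by
    have h1 : ∫ y in flow b s a..flow b s c, r.eval y ^ 2 ≤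
        ∫ y in flow b s a..flow b s c, (2 * (p.eval y - ψ y) ^ 2 + 2 * μ ^ 2) := by
      refine intervalIntegral.integral_mono_on hac'.le
        ((by fun_prop : Continuous fun y => r.eval y ^ 2).intervalIntegrable _ _)
        ((by fun_prop : Continuous fun y =>
          2 * (p.eval y - ψ y) ^ 2 + 2 * μ ^ 2).intervalIntegrable _ _) fun y hy => ?_
      have h2 := sq_le_sq' (abs_le.mp (hμ y hy)).1 (abs_le.mp (hμ y hy)).2
      rw [hr, Polynomial.eval_sub]
      nlinarith [sq_nonneg ((p.eval y - ψ y) - (ψ y - Q.eval y))]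
    rw [intervalIntegral.integral_add
      ((by fun_prop : Continuous fun y => 2 * (p.eval y - ψ y) ^ 2).intervalIntegrable _ _)
      (by simp), intervalIntegral.integral_const_mul, intervalIntegral.integral_const,
      smul_eq_mul, ← hl] at h1
    have hW2 : W ^ 2 = ∫ y in flow b s a..flow b s c, (p.eval y - ψ y) ^ 2 :=
      Real.sq_sqrt (intervalIntegral.integral_nonneg hac'.le fun _ _ => sq_nonneg _)
    rw [hV, Real.sqrt_le_left (by positivity)]
    have h3 : √l ^ 2 = l := Real.sq_sqrt hlpos.le
    have h4 : 0 ≤ W * (μ * √l) := by positivity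
    rw [← hW2] at h1
    nlinarith [sq_nonneg W, sq_nonneg μ, mul_nonneg (sq_nonneg μ) hlpos.le]
  have hsplit : ∀ x ∈ Ioo a c, ∀ z ε, |r.eval (flow b s x) - z| ≤ ε →
      |p.eval (flow b s x) - ψ (flow b s x) - z| ≤ μ + ε := fun x hx z ε hz => by
    have h1 := hμ (flow b s x) ⟨hmono.monotone hx.1.le, hmono.monotone hx.2.le⟩
    rw [hr, Polynomial.eval_sub] at hz
    rw [abs_le] at h1 hz ⊢
    constructor <;> linarith [h1.1, h1.2, hz.1, hz.2]
  have hint : IntervalIntegrable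
      (fun x => (p.eval (flow b s x) - ψ (flow b s x)) * φ.eval x) volume a c :=
    (by fun_prop : Continuous fun x =>
      (p.eval (flow b s x) - ψ (flow b s x)) * φ.eval x).intervalIntegrable _ _
  have hF : 0 ≤ F := Real.sqrt_nonneg _
  have hW0 : 0 ≤ W := Real.sqrt_nonneg _
  -- The factor `κ = C₂ s h²` depends on `b` and `T` and must not multiply `μ`. If `κ ≤ 1`, it is
  -- replaced by 1 in front of `μ` and kept in front of `W`. If `κ ≥ 1`, no approximation of the
  -- flow is needed, since a bound `O(W)` is already `O(κ W)`.
  rcases le_total (C₂ * s * h ^ 2) 1 with hκ | hκ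
  · obtain ⟨P, hP, hPx⟩ := H₂ s hs hsT a c hac hca r hrd
    have := Hg P φ hP hφ _ a c (μ + C₂ * s * h ^ 2 * V / √h) hac hint fun x hx =>
      hsplit x hx _ _ (by
        rw [le_div_iff₀ hsq, mul_comm]; exact hPx x (Ioo_subset_Icc_self hx))
    refine this.trans ?_
    have hκ0 : 0 ≤ C₂ * s * h ^ 2 := by positivity
    have e1 : (μ + C₂ * s * h ^ 2 * V / √h) * √h = μ * √h + C₂ * s * h ^ 2 * V := by
      field_simp
    rw [e1]
    have h2 : C₂ * s * h ^ 2 * V ≤ 2 * (C₂ * s * h ^ 2) * W + 2 * (μ * √l) := by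
      calc C₂ * s * h ^ 2 * V ≤ C₂ * s * h ^ 2 * (2 * (W + μ * √l)) := by gcongr
        _ = 2 * (C₂ * s * h ^ 2) * W + (C₂ * s * h ^ 2) * (2 * (μ * √l)) := by ring
        _ ≤ 2 * (C₂ * s * h ^ 2) * W + 1 * (2 * (μ * √l)) := by gcongr
        _ = _ := by ring
    calc Cg * ((μ * √h + C₂ * s * h ^ 2 * V) * F)
        ≤ Cg * ((μ * √h + (2 * (C₂ * s * h ^ 2) * W + 2 * (μ * √l))) * F) := by gcongr
      _ ≤ Cg * (((2 + 2 * C₃ * L) * (C₂ * s * h ^ 2) * W +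
          (2 + 2 * C₃) * (μ * (√h + √l))) * F) := by
          gcongr ?_ * (?_ * _)
          have t1 : 0 ≤ C₃ * L * (C₂ * s * h ^ 2 * W) := by positivity
          have t2 : 0 ≤ C₃ * (μ * (√h + √l)) := by positivity
          have t3 : 0 ≤ μ * √h := by positivity
          linarith
      _ = _ := by ring
  -- With the zero polynomial as approximation, `r` is bounded by its supremum on the image
  -- interval. The ratio `√h / √l` cancels against `√l` in the `μ` term, so `L` survives only in
  -- front of `W`.
  · have := Hg 0 φ (by simp) hφ _ a c (μ + C₃ * V / √l) hac hint fun x hx =>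
      hsplit x hx _ _ (by
        rw [le_div_iff₀ hsl, mul_comm, Polynomial.eval_zero, sub_zero]
        exact H₃ r hrd _ _ hac' _ ⟨hmono.monotone hx.1.le, hmono.monotone hx.2.le⟩)
    refine this.trans ?_
    have hhl : √h ≤ L * √l := by
      rw [Real.sqrt_le_left (by positivity), mul_pow, Real.sq_sqrt hlpos.le]
      have := hLip s hs hsT a c hac
      nlinarith
    have e1 : (μ + C₃ * V / √l) * √h = μ * √h + C₃ * (√h / √l) * V := by
      field_simp
    rw [e1]
    have hq : √h / √l ≤ L := by rwa [div_le_iff₀ hsl]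
    have h2 : C₃ * (√h / √l) * V ≤ 2 * C₃ * L * (C₂ * s * h ^ 2) * W + 2 * C₃ * (μ * √h) := by
      calc C₃ * (√h / √l) * V ≤ C₃ * (√h / √l) * (2 * (W + μ * √l)) := by gcongr
        _ = 2 * C₃ * (√h / √l) * 1 * W + 2 * C₃ * (μ * √h) := by field_simp
        _ ≤ _ := by gcongr
    calc Cg * ((μ * √h + C₃ * (√h / √l) * V) * F)
        ≤ Cg * ((μ * √h + (2 * C₃ * L * (C₂ * s * h ^ 2) * W + 2 * C₃ * (μ * √h))) * F) := by
          gcongr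
      _ ≤ Cg * (((2 + 2 * C₃ * L) * (C₂ * s * h ^ 2) * W +
          (2 + 2 * C₃) * (μ * (√h + √l))) * F) := by
          gcongr ?_ * (?_ * _)
          have t1 : 0 ≤ C₂ * s * h ^ 2 * W := by positivity
          have t2 : 0 ≤ C₃ * (μ * √l) := by positivity
          have t3 : 0 ≤ μ * √h := by positivity
          have t4 : 0 ≤ μ * √l := by positivity
          linarith
      _ = _ := by ring

end SLDG

/-! ### The nodes of the quadrature form -/

namespace SLDG

open Set Filter Topology MeasureTheory

/-- For indices in range the default value of `getD` plays no role. -/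
theorem sort_getD_eq {S : Finset ℝ} {q : ℕ} (hq : q < S.card) :
    (S.sort (· ≤ ·)).getD q 0 = S.orderEmbOfFin rfl ⟨q, hq⟩ := by
  rw [Finset.orderEmbOfFin_apply, List.getD_eq_getElem _ _ (by simpa using hq)]
  rfl

/-- The flow is injective, and only finitely many mesh points lie between the images of the two cell
ends. Thus `cellNodes` does contain the break points. -/
theorem finite_breakPoints {b : ℝ → ℝ} (hb : ContDiff ℝ 1 b) (hper : Function.Periodic b 1)
    (s : ℝ) {M : ℕ} (hM : 0 < M) (i : ℕ) : (breakPoints b s M i).Finite := by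
  have hM' : (0 : ℝ) < M := by exact_mod_cast hM
  set a := flow b s ((i : ℝ) / M)
  set c := flow b s (((i : ℝ) + 1) / M)
  have hmono := flow_strictMono hb hper s
  have hfin : ((fun l : ℤ => (l : ℝ) / M) '' Icc ⌈a * M⌉ ⌊c * M⌋).Finite :=
    (finite_Icc _ _).image _
  refine (hfin.preimage (f := flow b s) hmono.injective.injOn).subset ?_
  rintro x ⟨hx, l, hl⟩
  have hl' : flow b s x = (l : ℝ) / M := hl
  have h1 := hmono hx.1
  have h2 := hmono hx.2
  rw [hl'] at h1 h2
  refine ⟨l, ⟨?_, ?_⟩, hl'.symm⟩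
  · rw [Int.ceil_le]; exact ((lt_div_iff₀ hM').mp h1).le
  · rw [Int.le_floor]; exact ((div_lt_iff₀ hM').mp h2).le

theorem mem_cellNodes {b : ℝ → ℝ} (hb : ContDiff ℝ 1 b) (hper : Function.Periodic b 1)
    {s : ℝ} {M : ℕ} (hM : 0 < M) {i : ℕ} {x : ℝ} : x ∈ cellNodes b s M i ↔
      x = (i : ℝ) / M ∨ x = ((i : ℝ) + 1) / M ∨ x ∈ breakPoints b s M i := by
  rw [cellNodes, dif_pos (finite_breakPoints hb hper s hM i)]
  simp

/-- The indices `(i, q)` of the intervals `(x_{i,q}, x_{i,q+1})`. -/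
noncomputable def nodeIndex (b : ℝ → ℝ) (s : ℝ) (M : ℕ) : Finset (Σ _ : ℕ, ℕ) :=
  (Finset.range M).sigma fun i => Finset.range ((cellNodes b s M i).card - 1)

/-- The left end point of an interval of the quadrature form. -/
noncomputable def leftNode (b : ℝ → ℝ) (s : ℝ) (M : ℕ) (j : Σ _ : ℕ, ℕ) : ℝ :=
  cellNode b s M j.1 j.2

/-- The right end point of an interval of the quadrature form. -/
noncomputable def rightNode (b : ℝ → ℝ) (s : ℝ) (M : ℕ) (j : Σ _ : ℕ, ℕ) : ℝ :=
  cellNode b s M j.1 (j.2 + 1)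

theorem innerG_eq_sum (b : ℝ → ℝ) (s : ℝ) (M k : ℕ) (f g : ℝ → ℝ) :
    innerG b s M k f g = ∑ j ∈ nodeIndex b s M,
      gaussQuad k (leftNode b s M j) (rightNode b s M j) fun x => f x * g x := by
  rw [innerG, nodeIndex, Finset.sum_sigma]
  rfl

/-! ### Tiling by the node intervals and by their images. -/

section Nodes

variable {b : ℝ → ℝ} (hb : ContDiff ℝ 1 b) (hper : Function.Periodic b 1) (s : ℝ) {M : ℕ}
  (hM : 0 < M)

include hb hper hM

theorem cellNodes_bounds {i : ℕ} {x : ℝ} (hx : x ∈ cellNodes b s M i) :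
    x ∈ Icc ((i : ℝ) / M) (((i : ℝ) + 1) / M) := by
  have hM' : (0 : ℝ) < M := by exact_mod_cast hM
  have h : (i : ℝ) / M ≤ ((i : ℝ) + 1) / M := by gcongr; linarith
  rcases (mem_cellNodes hb hper hM).mp hx with rfl | rfl | hx
  · exact left_mem_Icc.mpr h
  · exact right_mem_Icc.mpr h
  · exact Ioo_subset_Icc_self hx.1

theorem cellNodes_card_pos (i : ℕ) : 0 < (cellNodes b s M i).card :=
  Finset.card_pos.mpr ⟨_, (mem_cellNodes hb hper hM).mpr (Or.inl rfl)⟩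

theorem cellNode_zero (i : ℕ) : cellNode b s M i 0 = (i : ℝ) / M := by
  have h0 := cellNodes_card_pos hb hper s hM i
  rw [cellNode, sort_getD_eq h0, Finset.orderEmbOfFin_zero rfl h0]
  refine le_antisymm (Finset.min'_le _ _ ((mem_cellNodes hb hper hM).mpr (Or.inl rfl))) ?_
  exact (cellNodes_bounds hb hper s hM (Finset.min'_mem _ _)).1

theorem cellNode_last (i : ℕ) :
    cellNode b s M i ((cellNodes b s M i).card - 1) = ((i : ℝ) + 1) / M := by
  have h0 := cellNodes_card_pos hb hper s hM i
  rw [cellNode, sort_getD_eq (Nat.sub_lt h0 one_pos), Finset.orderEmbOfFin_last rfl h0]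
  refine le_antisymm (cellNodes_bounds hb hper s hM (Finset.max'_mem _ _)).2 ?_
  exact Finset.le_max' _ _ ((mem_cellNodes hb hper hM).mpr (Or.inr (Or.inl rfl)))

/-- A point strictly between consecutive nodes whose image is a mesh point would itself be a node,
with index strictly between `q` and `q + 1`. -/
theorem node_facts {j : Σ _ : ℕ, ℕ} (hj : j ∈ nodeIndex b s M) :
    j.1 < M ∧ (j.1 : ℝ) / M ≤ leftNode b s M j ∧ leftNode b s M j < rightNode b s M j ∧
      rightNode b s M j ≤ ((j.1 : ℝ) + 1) / M ∧
      ∀ x ∈ Ioo (leftNode b s M j) (rightNode b s M j), ∀ l : ℤ, flow b s x ≠ (l : ℝ) / M := by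
  obtain ⟨i, q⟩ := j
  simp only [nodeIndex, Finset.mem_sigma, Finset.mem_range] at hj
  obtain ⟨hi, hq⟩ := hj
  simp only [leftNode, rightNode, cellNode]
  set S := cellNodes b s M i with hS
  have hq1 : q < S.card := by omega
  have hq2 : q + 1 < S.card := by omega
  rw [sort_getD_eq hq1, sort_getD_eq hq2]
  have hl := cellNodes_bounds hb hper s hM (S.orderEmbOfFin_mem rfl ⟨q, hq1⟩)
  have hr := cellNodes_bounds hb hper s hM (S.orderEmbOfFin_mem rfl ⟨q + 1, hq2⟩)
  refine ⟨hi, hl.1, (S.orderEmbOfFin rfl).strictMono (Fin.mk_lt_mk.mpr (Nat.lt_succ_self q)),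
    hr.2, fun x hx l hxl => ?_⟩
  have hxS : x ∈ S := (mem_cellNodes hb hper hM).mpr
    (Or.inr (Or.inr ⟨⟨hl.1.trans_lt hx.1, hx.2.trans_le hr.2⟩, l, hxl⟩))
  have hxr : x ∈ Set.range (S.orderEmbOfFin rfl) := by
    rw [Finset.range_orderEmbOfFin]; exact hxS
  obtain ⟨n, rfl⟩ := hxr
  have h1 := (S.orderEmbOfFin rfl).lt_iff_lt.mp hx.1
  have h2 := (S.orderEmbOfFin rfl).lt_iff_lt.mp hx.2
  rw [Fin.lt_def] at h1 h2
  simp only at h1 h2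
  omega

theorem node_mem_unit {j : Σ _ : ℕ, ℕ} (hj : j ∈ nodeIndex b s M) :
    0 ≤ leftNode b s M j ∧ rightNode b s M j ≤ 1 ∧
      rightNode b s M j - leftNode b s M j ≤ 1 / (M : ℝ) := by
  have hM' : (0 : ℝ) < M := by exact_mod_cast hM
  obtain ⟨hi, h1, h2, h3, -⟩ := node_facts hb hper s hM hj
  refine ⟨le_trans (by positivity) h1, h3.trans ?_, ?_⟩
  · rw [div_le_one hM']; exact_mod_cast hi
  · have : ((j.1 : ℝ) + 1) / M - (j.1 : ℝ) / M = 1 / M := by ring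
    linarith

/-- The image of an interval of the quadrature form lies in one mesh cell. -/
theorem exists_image_cell {j : Σ _ : ℕ, ℕ} (hj : j ∈ nodeIndex b s M) : ∃ l : ℤ,
    (l : ℝ) / M ≤ flow b s (leftNode b s M j) ∧
      flow b s (rightNode b s M j) ≤ ((l : ℝ) + 1) / M := by
  have hM' : (0 : ℝ) < M := by exact_mod_cast hM
  obtain ⟨-, -, hac, -, hno⟩ := node_facts hb hper s hM hj
  refine ⟨⌊flow b s (leftNode b s M j) * M⌋, ?_, ?_⟩
  · rw [div_le_iff₀ hM']; exact Int.floor_le _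
  -- Otherwise the image would cross the next mesh point, and the intermediate value theorem would
  -- produce a break point inside the interval.
  · by_contra! h
    have h1 : flow b s (leftNode b s M j) <
        ((⌊flow b s (leftNode b s M j) * M⌋ : ℝ) + 1) / M := by
      rw [lt_div_iff₀ hM']; exact Int.lt_floor_add_one _
    have hYc : Continuous (flow b s) :=
      (continuous_flow hb hper).comp (continuous_const.prodMk continuous_id)
    obtain ⟨x, hx, hxe⟩ := intermediate_value_Ioo hac.le hYc.continuousOn ⟨h1, h⟩
    exact hno x hx (⌊flow b s (leftNode b s M j) * M⌋ + 1) (by rw [hxe]; push_cast; rfl)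

/-- Taking for `H` a primitive, a primitive composed with the flow, the identity or the flow gives
the tiling identities used in the summation. -/
theorem sum_nodes_telescope (H : ℝ → ℝ) :
    ∑ j ∈ nodeIndex b s M, (H (rightNode b s M j) - H (leftNode b s M j)) = H 1 - H 0 := by
  have hM' : (M : ℝ) ≠ 0 := by exact_mod_cast hM.ne'
  rw [nodeIndex, Finset.sum_sigma]
  simp only [leftNode, rightNode]
  have h : ∀ i ∈ Finset.range M, ∑ q ∈ Finset.range ((cellNodes b s M i).card - 1),
      (H (cellNode b s M i (q + 1)) - H (cellNode b s M i q)) =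
      H (((i + 1 : ℕ) : ℝ) / M) - H ((i : ℝ) / M) := fun i _ => by
    rw [Finset.sum_range_sub (fun q => H (cellNode b s M i q)), cellNode_last hb hper s hM,
      cellNode_zero hb hper s hM]
    push_cast; rfl
  rw [Finset.sum_congr rfl h, Finset.sum_range_sub (fun i : ℕ => H ((i : ℝ) / M)), div_self hM']
  simp

theorem intervalIntegrable_of_nodes {g : ℝ → ℝ} (h : ∀ j ∈ nodeIndex b s M,
    IntervalIntegrable g volume (leftNode b s M j) (rightNode b s M j)) :
    IntervalIntegrable g volume 0 1 := by
  have hM' : (M : ℝ) ≠ 0 := by exact_mod_cast hM.ne'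
  have hcell : ∀ i < M, IntervalIntegrable g volume ((i : ℝ) / M) (((i + 1 : ℕ) : ℝ) / M) := by
    intro i hi
    have := IntervalIntegrable.trans_iterate (a := cellNode b s M i)
      (n := (cellNodes b s M i).card - 1) (f := g) (μ := volume) fun q hq =>
        h ⟨i, q⟩ (by simp only [nodeIndex, Finset.mem_sigma, Finset.mem_range]; exact ⟨hi, hq⟩)
    rw [cellNode_last hb hper s hM, cellNode_zero hb hper s hM] at this
    push_cast; exact this
  have := IntervalIntegrable.trans_iterate (a := fun i : ℕ => (i : ℝ) / M) (n := M) hcell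
  simpa [hM'] using this

theorem sum_integral_nodes {g : ℝ → ℝ} (h : IntervalIntegrable g volume 0 1) :
    ∑ j ∈ nodeIndex b s M, ∫ x in leftNode b s M j..rightNode b s M j, g x =
      ∫ x in (0 : ℝ)..1, g x := by
  have := sum_nodes_telescope hb hper s hM (fun y => ∫ x in (0 : ℝ)..y, g x)
  simp only [intervalIntegral.integral_same, sub_zero] at this
  rw [← this]
  refine Finset.sum_congr rfl fun j hj => ?_
  obtain ⟨-, -, hac, -, -⟩ := node_facts hb hper s hM hj
  obtain ⟨h0, h1, -⟩ := node_mem_unit hb hper s hM hj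
  have hsub : ∀ y ∈ Icc (0 : ℝ) 1, IntervalIntegrable g volume 0 y := fun y hy =>
    h.mono_set (uIcc_subset_uIcc left_mem_uIcc (by rwa [uIcc_of_le zero_le_one]))
  exact (intervalIntegral.integral_interval_sub_left
    (hsub _ ⟨by linarith, h1⟩) (hsub _ ⟨h0, by linarith⟩)).symm

/-- The images tile the interval from `Y 0` to `Y 1 = Y 0 + 1`, a full period. The integrals are
taken over the images themselves, so no Jacobian appears. -/
theorem sum_integral_flow_nodes {g : ℝ → ℝ} (hg : Function.Periodic g 1)
    (h : IntervalIntegrable g volume 0 1) :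
    ∑ j ∈ nodeIndex b s M,
      ∫ y in flow b s (leftNode b s M j)..flow b s (rightNode b s M j), g y =
      ∫ x in (0 : ℝ)..1, g x := by
  have hall := hg.intervalIntegrable₀ one_ne_zero h
  have := sum_nodes_telescope hb hper s hM (fun z => ∫ y in (0 : ℝ)..flow b s z, g y)
  have h1 : flow b s 1 = flow b s 0 + 1 := by simpa using flow_add_one hb hper s 0
  simp only [intervalIntegral.integral_interval_sub_left (hall _ _) (hall _ _)] at this
  rw [this, h1, hg.intervalIntegral_add_eq _ 0, zero_add]

theorem sum_sub_nodes :
    ∑ j ∈ nodeIndex b s M, (rightNode b s M j - leftNode b s M j) = 1 := by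
  simpa using sum_nodes_telescope hb hper s hM id

theorem sum_flow_sub_nodes : ∑ j ∈ nodeIndex b s M,
    (flow b s (rightNode b s M j) - flow b s (leftNode b s M j)) = 1 := by
  have h1 : flow b s 1 = flow b s 0 + 1 := by simpa using flow_add_one hb hper s 0
  rw [sum_nodes_telescope hb hper s hM (flow b s), h1]; ring

end Nodes

/-- An element of `V_k` is a polynomial on every cell of the periodic mesh. -/
theorem dgSpace_int_cell {M k : ℕ} (hM : 0 < M) {u : ℝ → ℝ} (hu : u ∈ dgSpace M k) (l : ℤ) :
    ∃ p : Polynomial ℝ, p.natDegree ≤ k ∧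
      ∀ x ∈ Ico ((l : ℝ) / M) (((l : ℝ) + 1) / M), u x = p.eval x := by
  have hM' : (0 : ℝ) < M := by exact_mod_cast hM
  have hMz : (0 : ℤ) < M := by exact_mod_cast hM
  obtain ⟨i, hi⟩ := Int.eq_ofNat_of_zero_le (Int.emod_nonneg l hMz.ne')
  have hiM : i < M := by
    have := Int.emod_lt_of_pos l hMz
    omega
  set d := l / (M : ℤ) with hd
  have hl : (l : ℝ) = M * d + i := by
    have := Int.mul_ediv_add_emod l M
    rw [hi] at this
    exact_mod_cast this.symm
  obtain ⟨p, hp, hpu⟩ := hu.2 i hiM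
  -- The translate `x ↦ p (x - d)`, where `d` is the number of periods separating cell `l` from its
  -- representative `i` in `(0, 1)`.
  refine ⟨rescale p (-d) 1, (natDegree_rescale_le _ _ _).trans hp, fun x hx => ?_⟩
  have e1 : (l : ℝ) / M = d + i / M := by rw [hl]; field_simp
  have e2 : ((l : ℝ) + 1) / M = d + (i + 1) / M := by rw [hl]; field_simp; ring
  rw [e1, e2] at hx
  rw [eval_rescale, ← hpu _ ⟨by linarith [hx.1], by linarith [hx.2]⟩]
  have := (hu.1.int_mul d).sub_eq x
  rw [← this]
  congr 1; ring

/-- `(u - ψ)²` is integrable for `u` in `V_k` and continuous `ψ`. -/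
theorem intervalIntegrable_sub_sq {M k : ℕ} (hM : 0 < M) {u ψ : ℝ → ℝ} (hu : u ∈ dgSpace M k)
    (hψ : Continuous ψ) : IntervalIntegrable (fun x => (u x - ψ x) ^ 2) volume 0 1 := by
  have hM' : (M : ℝ) ≠ 0 := by exact_mod_cast hM.ne'
  have := IntervalIntegrable.trans_iterate (a := fun i : ℕ => (i : ℝ) / M) (n := M)
    (f := fun x => (u x - ψ x) ^ 2) (μ := volume) fun i hi => by
      obtain ⟨p, -, hp⟩ := hu.2 i hi
      have hle : (i : ℝ) / M ≤ ((i + 1 : ℕ) : ℝ) / M := by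
        gcongr; exact_mod_cast Nat.le_succ i
      refine ((by fun_prop : Continuous fun x => (p.eval x - ψ x) ^ 2).intervalIntegrable
        _ _).congr_uIoo fun x hx => ?_
      rw [uIoo_of_le hle] at hx
      push_cast at hx
      simp only
      rw [hp x (Ioo_subset_Ico_self hx)]
  simpa [hM'] using this

/-- An element of `V_k` is a polynomial on every interval of the quadrature form. -/
theorem exists_eval_eq_of_nodes {b : ℝ → ℝ} (hb : ContDiff ℝ 1 b) (hper : Function.Periodic b 1)
    {s : ℝ} {M k : ℕ} (hM : 0 < M) {φ : ℝ → ℝ} (hφ : φ ∈ dgSpace M k) {j : Σ _ : ℕ, ℕ}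
    (hj : j ∈ nodeIndex b s M) : ∃ p : Polynomial ℝ, p.natDegree ≤ k ∧
      ∀ x ∈ Ioo (leftNode b s M j) (rightNode b s M j), φ x = p.eval x := by
  obtain ⟨hi, h1, -, h3, -⟩ := node_facts hb hper s hM hj
  obtain ⟨p, hp, hpe⟩ := hφ.2 j.1 hi
  exact ⟨p, hp, fun x hx => hpe x ⟨h1.trans hx.1.le, hx.2.trans_le h3⟩⟩

/-- Summation of local quadrature errors. -/
theorem abs_innerG_sub_innerL2_le_sum {b : ℝ → ℝ} (hb : ContDiff ℝ 1 b)
    (hper : Function.Periodic b 1) {s : ℝ} {M k : ℕ} (hM : 0 < M) {f φ : ℝ → ℝ}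
    (hφ : φ ∈ dgSpace M k) {E : (Σ _ : ℕ, ℕ) → ℝ}
    (h : ∀ j ∈ nodeIndex b s M, ∀ p : Polynomial ℝ, p.natDegree ≤ k →
      IntervalIntegrable (fun x => f x * p.eval x) volume (leftNode b s M j) (rightNode b s M j) ∧
      |gaussQuad k (leftNode b s M j) (rightNode b s M j) (fun x => f x * p.eval x) -
        ∫ x in leftNode b s M j..rightNode b s M j, f x * p.eval x| ≤
        E j * √(∫ x in leftNode b s M j..rightNode b s M j, p.eval x ^ 2)) :
    IntervalIntegrable (fun x => f x * φ x) volume 0 1 ∧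
    |innerG b s M k f φ - innerL2 f φ| ≤ ∑ j ∈ nodeIndex b s M,
      E j * √(∫ x in leftNode b s M j..rightNode b s M j, φ x ^ 2) := by
  have hJ : ∀ j ∈ nodeIndex b s M,
      IntervalIntegrable (fun x => f x * φ x) volume (leftNode b s M j) (rightNode b s M j) ∧
      |gaussQuad k (leftNode b s M j) (rightNode b s M j) (fun x => f x * φ x) -
        ∫ x in leftNode b s M j..rightNode b s M j, f x * φ x| ≤
        E j * √(∫ x in leftNode b s M j..rightNode b s M j, φ x ^ 2) := by
    intro j hj
    obtain ⟨p, hp, hpe⟩ := exists_eval_eq_of_nodes hb hper hM hφ hj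
    obtain ⟨-, -, hac, -, -⟩ := node_facts hb hper s hM hj
    obtain ⟨h1, h2⟩ := h j hj p hp
    have e1 : ∀ x ∈ Ioo (leftNode b s M j) (rightNode b s M j), f x * p.eval x = f x * φ x :=
      fun x hx => by rw [hpe x hx]
    have e1' : EqOn (fun x => f x * p.eval x) (fun x => f x * φ x)
        (uIoo (leftNode b s M j) (rightNode b s M j)) := fun x hx => by
      rw [uIoo_of_le hac.le] at hx; exact e1 x hx
    have e2 : EqOn (fun x => p.eval x ^ 2) (fun x => φ x ^ 2)
        (uIoo (leftNode b s M j) (rightNode b s M j)) := fun x hx => by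
      rw [uIoo_of_le hac.le] at hx; simp only; rw [hpe x hx]
    rw [gaussQuad_congr hac e1, intervalIntegral.integral_congr_uIoo e1',
      intervalIntegral.integral_congr_uIoo e2] at h2
    exact ⟨h1.congr_uIoo e1', h2⟩
  have hint := intervalIntegrable_of_nodes hb hper s hM fun j hj => (hJ j hj).1
  refine ⟨hint, ?_⟩
  rw [innerG_eq_sum, innerL2, ← sum_integral_nodes hb hper s hM hint, ← Finset.sum_sub_distrib]
  exact (Finset.abs_sum_le_sum_abs _ _).trans (Finset.sum_le_sum fun j hj => (hJ j hj).2)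

/-- Cauchy–Schwarz over the intervals, which tile `(0, 1)`, so that the local squared norms of `φ`
add up to the global one. -/
theorem sum_sqrt_mul_le {b : ℝ → ℝ} (hb : ContDiff ℝ 1 b) (hper : Function.Periodic b 1) {s : ℝ}
    {M k : ℕ} (hM : 0 < M) {φ : ℝ → ℝ} (hφ : φ ∈ dgSpace M k) {e : (Σ _ : ℕ, ℕ) → ℝ}
    (he : ∀ j ∈ nodeIndex b s M, 0 ≤ e j) :
    ∑ j ∈ nodeIndex b s M, √(e j) * √(∫ x in leftNode b s M j..rightNode b s M j, φ x ^ 2) ≤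
      √(∑ j ∈ nodeIndex b s M, e j) * normL2 φ := by
  refine (Real.sum_mul_le_sqrt_mul_sqrt _ _ _).trans (le_of_eq ?_)
  have h2 : IntervalIntegrable (fun x => φ x ^ 2) volume 0 1 := by
    simpa [sq] using dgSpace_integrable hM hφ hφ
  rw [normL2, ← sum_integral_nodes hb hper s hM h2]
  congr 2
  · exact Finset.sum_congr rfl fun j hj => Real.sq_sqrt (he j hj)
  · refine Finset.sum_congr rfl fun j hj => Real.sq_sqrt ?_
    obtain ⟨-, -, hac, -, -⟩ := node_facts hb hper s hM hj
    exact intervalIntegral.integral_nonneg hac.le fun _ _ => sq_nonneg _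

end SLDG

/-! ### Bounds on derivatives and the error estimates -/

namespace SLDG

open Set Filter Topology MeasureTheory

/-- A continuous function on `[0, 1]` is bounded on `(0, 1)` by its essential supremum. -/
theorem abs_le_eLpNorm_top {f g : ℝ → ℝ} (hg : ContinuousOn g (Icc 0 1))
    (hfg : EqOn f g (Ioo 0 1)) {x : ℝ} (hx : x ∈ Ioo (0 : ℝ) 1) :
    |f x| ≤ (eLpNorm f ⊤ (volume.restrict (Ioo (0 : ℝ) 1))).toReal := by
  obtain ⟨B, hB⟩ := isCompact_Icc.exists_bound_of_continuousOn hg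
  -- Finiteness is essential: `toReal` would send an infinite norm to zero.
  have hfin : eLpNorm f ⊤ (volume.restrict (Ioo (0 : ℝ) 1)) < ⊤ := by
    rw [eLpNorm_exponent_top]
    refine eLpNormEssSup_lt_top_of_ae_bound (C := B) ?_
    rw [ae_restrict_iff' measurableSet_Ioo]
    refine Eventually.of_forall fun y hy => ?_
    rw [hfg hy]
    exact hB y (Ioo_subset_Icc_self hy)
  set N := (eLpNorm f ⊤ (volume.restrict (Ioo (0 : ℝ) 1))).toReal with hN
  by_contra! hlt
  have hae : ∀ᵐ y ∂volume.restrict (Ioo (0 : ℝ) 1), |f y| ≤ N := by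
    filter_upwards [enorm_ae_le_eLpNormEssSup f (volume.restrict (Ioo (0 : ℝ) 1))] with y hy
    rw [← eLpNorm_exponent_top] at hy
    have := ENNReal.toReal_mono hfin.ne hy
    rwa [toReal_enorm, Real.norm_eq_abs] at this
  have hfc : ContinuousOn f (Ioo 0 1) :=
    (hg.mono Ioo_subset_Icc_self).congr hfg
  have hopen : IsOpen (Ioo (0 : ℝ) 1 ∩ f ⁻¹' {z | N < |z|}) :=
    hfc.isOpen_inter_preimage isOpen_Ioo (isOpen_lt continuous_const continuous_abs)
  -- The set where `|f|` exceeds the essential supremum is open and, by assumption, nonempty, so it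
  -- has positive measure.
  have hpos := hopen.measure_pos volume ⟨x, hx, hlt⟩
  rw [ae_restrict_iff' measurableSet_Ioo, ae_iff] at hae
  refine hpos.ne' (measure_mono_null (fun y hy => ?_) hae)
  simp only [mem_ofPred_eq, Classical.not_imp, not_le]
  exact ⟨hy.1, hy.2⟩

theorem maxDeriv_nonneg (p : ℕ) (ψ : ℝ → ℝ) : 0 ≤ maxDeriv p ψ :=
  ENNReal.toReal_nonneg.trans (Finset.le_sup' (fun r =>
    (eLpNorm (iteratedDeriv r ψ) ⊤ (volume.restrict (Ioo (0 : ℝ) 1))).toReal)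
      (Finset.mem_range.mpr (Nat.succ_pos p)))

theorem maxDeriv_zero (p : ℕ) : maxDeriv p 0 = 0 := by
  have : ∀ r, iteratedDeriv r (0 : ℝ → ℝ) = 0 := fun r => by
    funext x; simp
  simp only [maxDeriv, this, eLpNorm_zero, ENNReal.toReal_zero]
  exact Finset.sup'_const _ 0

/-- The derivatives within `[0, 1]` are continuous up to the boundary and agree with `iteratedDeriv`
in the interior, which gives the required boundedness. -/
theorem abs_iteratedDeriv_le_maxDeriv {p : ℕ} {ψ : ℝ → ℝ}
    (hψ : ContDiffOn ℝ p ψ (Icc 0 1)) {r : ℕ} (hr : r ≤ p) {x : ℝ} (hx : x ∈ Ioo (0 : ℝ) 1) :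
    |iteratedDeriv r ψ x| ≤ maxDeriv p ψ := by
  have hu : UniqueDiffOn ℝ (Icc (0 : ℝ) 1) := uniqueDiffOn_Icc one_pos
  have hr' : (r : WithTop ℕ∞) ≤ p := by exact_mod_cast hr
  refine (abs_le_eLpNorm_top (hψ.continuousOn_iteratedDerivWithin hr' hu)
    (fun y hy => ?_) hx).trans (Finset.le_sup' (fun r =>
      (eLpNorm (iteratedDeriv r ψ) ⊤ (volume.restrict (Ioo (0 : ℝ) 1))).toReal)
        (Finset.mem_range.mpr (Nat.lt_succ_of_le hr)))
  exact (iteratedDerivWithin_eq_iteratedDeriv hu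
    ((hψ.contDiffAt (Icc_mem_nhds hy.1 hy.2)).of_le hr') (Ioo_subset_Icc_self hy)).symm

theorem abs_iteratedDeriv_le_maxDeriv_of_periodic {p : ℕ} {ψ : ℝ → ℝ} (hψ : ContDiff ℝ p ψ)
    (hper : Function.Periodic ψ 1) {r : ℕ} (hr : r ≤ p) (x : ℝ) :
    |iteratedDeriv r ψ x| ≤ maxDeriv p ψ := by
  have hc : Continuous (iteratedDeriv r ψ) :=
    hψ.continuous_iteratedDeriv r (by exact_mod_cast hr)
  have hsub : Icc (0 : ℝ) 1 ⊆ {x | |iteratedDeriv r ψ x| ≤ maxDeriv p ψ} := by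
    rw [← closure_Ioo (by norm_num : (0 : ℝ) ≠ 1)]
    exact closure_minimal (fun y hy => abs_iteratedDeriv_le_maxDeriv hψ.contDiffOn hr hy)
      (isClosed_le hc.abs continuous_const)
  obtain ⟨y, hy, h⟩ := (periodic_iteratedDeriv hper r).exists_mem_Ico₀ one_pos x
  rw [h]
  exact hsub (Ico_subset_Icc_self hy)

/-- The quadrature error for a function with bounded derivative of order `k + 1`. -/
theorem exists_innerG_smooth_error_le (k : ℕ) : ∃ C : ℝ, 0 ≤ C ∧ ∀ b : ℝ → ℝ, ContDiff ℝ 1 b →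
    Function.Periodic b 1 → ∀ (s : ℝ) (M : ℕ), 0 < M → ∀ (f : ℝ → ℝ) (D : ℝ),
    ContDiffOn ℝ (k + 1 : ℕ) f (Icc 0 1) → (∀ x ∈ Ioo 0 1, |iteratedDeriv (k + 1) f x| ≤ D) →
    ∀ φ ∈ dgSpace M k, IntervalIntegrable (fun x => f x * φ x) volume 0 1 ∧
      |innerG b s M k f φ - innerL2 f φ| ≤ C * D * (1 / (M : ℝ)) ^ (k + 1) * normL2 φ := by
  obtain ⟨C, hC, H⟩ := exists_gaussQuad_error_le k
  refine ⟨C, hC, fun b hb hper s M hM f D hf hD φ hφ => ?_⟩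
  have hD0 : 0 ≤ D := (abs_nonneg _).trans (hD (1 / 2) ⟨by norm_num, by norm_num⟩)
  -- The bound `D` stays free: (iii) takes `maxDeriv` of `ψ` itself, (iv) a multiple of it for the
  -- transported function.
  set μ := D * (1 / (M : ℝ)) ^ (k + 1) with hμ
  have hμ0 : 0 ≤ μ := by positivity
  obtain ⟨hint, h⟩ := abs_innerG_sub_innerL2_le_sum hb hper hM (s := s) (f := f) hφ
    (E := fun j => C * μ * √(rightNode b s M j - leftNode b s M j)) fun j hj p hp => by
      obtain ⟨-, -, hac, -, -⟩ := node_facts hb hper s hM hj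
      obtain ⟨h0, h1, hh⟩ := node_mem_unit hb hper s hM hj
      have hsub : Icc (leftNode b s M j) (rightNode b s M j) ⊆ Icc 0 1 := Icc_subset_Icc h0 h1
      have hint : IntervalIntegrable (fun x => f x * p.eval x) volume
          (leftNode b s M j) (rightNode b s M j) := by
        refine ContinuousOn.intervalIntegrable_of_Icc hac.le ?_
        exact (hf.continuousOn.mono hsub).mul p.continuous.continuousOn
      refine ⟨hint, ?_⟩
      obtain ⟨P, hP, hPf⟩ := exists_polynomial_approx hac (hf.mono hsub)
        fun x hx => hD x ⟨h0.trans_lt hx.1, hx.2.trans_le h1⟩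
      refine (H P p (by omega) hp f _ _ μ hac hint fun x hx =>
        (hPf x (Ioo_subset_Icc_self hx)).trans ?_).trans (le_of_eq (by ring))
      have : 0 ≤ rightNode b s M j - leftNode b s M j := by linarith
      rw [hμ]; gcongr
  refine ⟨hint, h.trans ?_⟩
  simp only [mul_assoc (C * μ)]
  rw [← Finset.mul_sum]
  have hsum := sum_sqrt_mul_le hb hper (s := s) hM hφ
    (e := fun j => rightNode b s M j - leftNode b s M j) fun j hj => by
      obtain ⟨-, -, hac, -, -⟩ := node_facts hb hper s hM hj
      linarith
  rw [sum_sub_nodes hb hper s hM, Real.sqrt_one, one_mul] at hsum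
  calc _ ≤ C * μ * normL2 φ := by gcongr
    _ = _ := by rw [hμ]; ring

/-- The quadrature error for the transport of `u - ψ`. -/
theorem exists_innerG_transport_error_le (k : ℕ) : ∃ C₀ : ℝ, 0 ≤ C₀ ∧ ∀ b : ℝ → ℝ,
    ContDiff ℝ (2 * k + 2 : ℕ) b → Function.Periodic b 1 → ∀ T : ℝ, 0 < T → ∃ C : ℝ, 0 ≤ C ∧
    ∀ s, 0 < s → s ≤ T → ∀ M : ℕ, 0 < M → ∀ u ∈ dgSpace M k, ∀ ψ : ℝ → ℝ,
    ContDiff ℝ (k + 1 : ℕ) ψ → Function.Periodic ψ 1 → ∀ φ ∈ dgSpace M k,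
    IntervalIntegrable (fun x => (transport b s u - transport b s ψ) x * φ x) volume 0 1 ∧
    |innerG b s M k (transport b s u - transport b s ψ) φ -
        innerL2 (transport b s u - transport b s ψ) φ| ≤
      C * s * (1 / (M : ℝ)) ^ 2 * normL2 (u - ψ) * normL2 φ +
        C₀ * maxDeriv (k + 1) ψ * (1 / (M : ℝ)) ^ (k + 1) * normL2 φ := by
  obtain ⟨C₀, hC₀, H₀⟩ := exists_interval_error_le k
  -- The factor 2 comes from the two sums with `√h` and `√l`, each at most `‖φ‖` because both
  -- families of lengths add up to 1.
  refine ⟨2 * C₀, by positivity, fun b hb hper T hT => ?_⟩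
  obtain ⟨C, hC, H⟩ := H₀ b hb hper T hT
  refine ⟨C, hC, fun s hs hsT M hM u hu ψ hψ hψper φ hφ => ?_⟩
  have hb1 : ContDiff ℝ 1 b := hb.of_le (by exact_mod_cast (by omega : 1 ≤ 2 * k + 2))
  have hmono := flow_strictMono hb1 hper s
  have hM1 : (1 : ℝ) ≤ M := by exact_mod_cast hM
  have hYc : Continuous (flow b s) :=
    (continuous_flow hb1 hper).comp (continuous_const.prodMk continuous_id)
  set μ := maxDeriv (k + 1) ψ * (1 / (M : ℝ)) ^ (k + 1) with hμ
  have hμ0 : 0 ≤ μ := mul_nonneg (maxDeriv_nonneg _ _) (by positivity)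
  set κ := C * s * (1 / (M : ℝ)) ^ 2 with hκ
  have hκ0 : 0 ≤ κ := by positivity
  set f := transport b s u - transport b s ψ with hf
  set wK : (Σ _ : ℕ, ℕ) → ℝ := fun j =>
    ∫ y in flow b s (leftNode b s M j)..flow b s (rightNode b s M j), (u y - ψ y) ^ 2 with hwK
  set hJ : (Σ _ : ℕ, ℕ) → ℝ := fun j => rightNode b s M j - leftNode b s M j with hhJ
  set lJ : (Σ _ : ℕ, ℕ) → ℝ := fun j =>
    flow b s (rightNode b s M j) - flow b s (leftNode b s M j) with hlJ
  obtain ⟨hint, h⟩ := abs_innerG_sub_innerL2_le_sum hb1 hper hM (s := s) (f := f) hφ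
    (E := fun j => κ * √(wK j) + C₀ * μ * (√(hJ j) + √(lJ j))) fun j hj φ' hφ' => by
      obtain ⟨-, -, hac, -, -⟩ := node_facts hb1 hper s hM hj
      obtain ⟨-, -, hh⟩ := node_mem_unit hb1 hper s hM hj
      obtain ⟨l, hl1, hl2⟩ := exists_image_cell hb1 hper s hM hj
      obtain ⟨p, hp, hpe⟩ := dgSpace_int_cell hM hu l
      have hac' := hmono hac
      have hpK : ∀ y ∈ Ioo (flow b s (leftNode b s M j)) (flow b s (rightNode b s M j)),
          u y = p.eval y := fun y hy => hpe y ⟨hl1.trans hy.1.le, hy.2.trans_le hl2⟩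
      have hfx : ∀ x ∈ Ioo (leftNode b s M j) (rightNode b s M j),
          (p.eval (flow b s x) - ψ (flow b s x)) * φ'.eval x = f x * φ'.eval x := fun x hx => by
        rw [← hpK _ ⟨hmono hx.1, hmono hx.2⟩]; rfl
      have hfx' : EqOn (fun x => (p.eval (flow b s x) - ψ (flow b s x)) * φ'.eval x)
          (fun x => f x * φ'.eval x) (uIoo (leftNode b s M j) (rightNode b s M j)) :=
        fun x hx => by rw [uIoo_of_le hac.le] at hx; exact hfx x hx
      obtain ⟨Q, hQ, hQψ⟩ := exists_polynomial_approx hac' hψ.contDiffOn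
        fun x _ => abs_iteratedDeriv_le_maxDeriv_of_periodic hψ hψper le_rfl x
      -- The image lies in one mesh cell, so its length is at most `Δx` without any Lipschitz
      -- constant of the flow. This keeps `μ` independent of `b` and `T`.
      have hl3 : flow b s (rightNode b s M j) - flow b s (leftNode b s M j) ≤ 1 / (M : ℝ) := by
        have : ((l : ℝ) + 1) / M - (l : ℝ) / M = 1 / M := by ring
        linarith
      have hQμ : ∀ y ∈ Icc (flow b s (leftNode b s M j)) (flow b s (rightNode b s M j)),
          |ψ y - Q.eval y| ≤ μ := fun y hy => (hQψ y hy).trans (by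
        have h1 := maxDeriv_nonneg (k + 1) ψ
        have h2 : 0 ≤ flow b s (rightNode b s M j) - flow b s (leftNode b s M j) := by linarith
        rw [hμ]; gcongr)
      have hψc := hψ.continuous
      have hle1 : 1 / (M : ℝ) ≤ 1 := by rw [div_le_one (by linarith)]; exact hM1
      have key := H s hs hsT _ _ hac (by linarith) p φ' Q hp hφ' hQ ψ μ hψc hQμ
      rw [gaussQuad_congr hac hfx, intervalIntegral.integral_congr_uIoo hfx'] at key
      refine ⟨((by fun_prop : Continuous fun x =>
        (p.eval (flow b s x) - ψ (flow b s x)) * φ'.eval x).intervalIntegrable _ _).congr_uIoo hfx',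
        key.trans ?_⟩
      have hW : ∫ y in flow b s (leftNode b s M j)..flow b s (rightNode b s M j),
          (p.eval y - ψ y) ^ 2 = wK j := by
        refine intervalIntegral.integral_congr_uIoo fun y hy => ?_
        rw [uIoo_of_le hac'.le] at hy
        rw [hpK y hy]
      rw [hW]
      have h3 : 0 ≤ rightNode b s M j - leftNode b s M j := by linarith
      rw [hκ]
      gcongr
  refine ⟨hint, h.trans ?_⟩
  have hw2 : IntervalIntegrable (fun x => (u x - ψ x) ^ 2) volume 0 1 :=
    intervalIntegrable_sub_sq hM hu hψ.continuous
  have hwper : Function.Periodic (fun x => (u x - ψ x) ^ 2) 1 := fun x => by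
    simp only [hu.1 x, hψper x]
  have s1 := sum_sqrt_mul_le hb1 hper (s := s) hM hφ (e := wK) fun j hj => by
    obtain ⟨-, -, hac, -, -⟩ := node_facts hb1 hper s hM hj
    exact intervalIntegral.integral_nonneg (hmono hac).le fun _ _ => sq_nonneg _
  have s2 := sum_sqrt_mul_le hb1 hper (s := s) hM hφ (e := hJ) fun j hj => by
    obtain ⟨-, -, hac, -, -⟩ := node_facts hb1 hper s hM hj
    exact sub_nonneg.mpr hac.le
  have s3 := sum_sqrt_mul_le hb1 hper (s := s) hM hφ (e := lJ) fun j hj => by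
    obtain ⟨-, -, hac, -, -⟩ := node_facts hb1 hper s hM hj
    exact sub_nonneg.mpr (hmono hac).le
  rw [hwK, sum_integral_flow_nodes hb1 hper s hM hwper hw2, ← hwK] at s1
  rw [hhJ, sum_sub_nodes hb1 hper s hM, ← hhJ, Real.sqrt_one, one_mul] at s2
  rw [hlJ, sum_flow_sub_nodes hb1 hper s hM, ← hlJ, Real.sqrt_one, one_mul] at s3
  have hn : √(∫ x in (0 : ℝ)..1, (u x - ψ x) ^ 2) = normL2 (u - ψ) := rfl
  rw [hn] at s1
  set F : (Σ _ : ℕ, ℕ) → ℝ := fun j =>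
    √(∫ x in leftNode b s M j..rightNode b s M j, φ x ^ 2)
  calc ∑ j ∈ nodeIndex b s M, (κ * √(wK j) + C₀ * μ * (√(hJ j) + √(lJ j))) * F j
      = κ * ∑ j ∈ nodeIndex b s M, √(wK j) * F j +
        C₀ * μ * (∑ j ∈ nodeIndex b s M, √(hJ j) * F j +
          ∑ j ∈ nodeIndex b s M, √(lJ j) * F j) := by
        rw [← Finset.sum_add_distrib, Finset.mul_sum, Finset.mul_sum, ← Finset.sum_add_distrib]
        exact Finset.sum_congr rfl fun j _ => by ring
    _ ≤ κ * (normL2 (u - ψ) * normL2 φ) + C₀ * μ * (normL2 φ + normL2 φ) := by gcongr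
    _ = _ := by rw [hμ]; ring

/-- The derivatives of `ψ ∘ y_·(-s)` are bounded by those of `ψ`. -/
theorem exists_iteratedDeriv_comp_flow_le {b : ℝ → ℝ} (hb : ContDiff ℝ 1 b)
    (hper : Function.Periodic b 1) {n : ℕ} (hn : ContDiff ℝ n b) {T : ℝ} (hT : 0 < T) :
    ∃ C, 0 ≤ C ∧ ∀ s, 0 < s → s ≤ T → ∀ ψ : ℝ → ℝ, ContDiff ℝ n ψ → Function.Periodic ψ 1 →
      ContDiff ℝ n (transport b s ψ) ∧
      ∀ x, |iteratedDeriv n (transport b s ψ) x| ≤ C * maxDeriv n ψ := by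
  obtain ⟨B, hB0, hB⟩ := exists_abs_iteratedDeriv_flow_sub_le hb hper hn hT
  refine ⟨n.factorial * (1 + B * T) ^ n, by positivity, fun s hs hsT ψ hψ hψper => ?_⟩
  have hY : ContDiff ℝ n (flow b s) := (jointlySmooth_flow hb hper hn).contDiff s
  have e : transport b s ψ = ψ ∘ flow b s := rfl
  rw [e]
  refine ⟨hψ.comp hY, fun x => ?_⟩
  have hBT : 1 ≤ 1 + B * T := by nlinarith [mul_nonneg hB0 hT.le]
  have hid : ∀ i, 1 ≤ i → ∀ x : ℝ, |iteratedDeriv i (fun x : ℝ => x) x| ≤ 1 := by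
    intro i hi x
    obtain ⟨i, rfl⟩ := Nat.exists_eq_add_of_le' hi
    have : deriv (fun x : ℝ => x) = fun _ => 1 := by funext x; exact deriv_id x
    rw [iteratedDeriv_succ', this, iteratedDeriv_const]
    split_ifs <;> simp
  -- Each derivative of `Y = id + (Y - id)` is at most `1 + B T`; raising this to the power `i`
  -- gives the form required by the Faà di Bruno estimate, which also supplies the factor `n!`.
  have hYi : ∀ i, 1 ≤ i → i ≤ n → ‖iteratedFDeriv ℝ i (flow b s) x‖ ≤ (1 + B * T) ^ i := by
    intro i hi hin
    rw [norm_iteratedFDeriv_eq_norm_iteratedDeriv, Real.norm_eq_abs]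
    refine le_trans ?_ (le_self_pow₀ hBT (by omega))
    have hin' : (i : WithTop ℕ∞) ≤ n := by exact_mod_cast hin
    have h1 : iteratedDeriv i (flow b s) x =
        iteratedDeriv i (fun x => flow b s x - x) x + iteratedDeriv i (fun x : ℝ => x) x := by
      have h2 : ContDiffAt ℝ i (fun x => flow b s x - x) x :=
        ((hY.sub contDiff_id).contDiffAt).of_le hin'
      have h3 := iteratedDeriv_fun_add h2
        (show ContDiffAt ℝ i (fun x : ℝ => x) x from contDiff_id.contDiffAt)
      rw [← h3]
      simp only [sub_add_cancel]
    rw [h1]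
    refine (abs_add_le _ _).trans ?_
    have h4 := hB s hs hsT x i hin
    have h5 : B * s ≤ B * T := by gcongr
    linarith [hid i hi x]
  have := norm_iteratedFDeriv_comp_le hψ hY le_rfl x (C := maxDeriv n ψ) (D := 1 + B * T)
    (fun i hi => by
      rw [norm_iteratedFDeriv_eq_norm_iteratedDeriv]
      exact abs_iteratedDeriv_le_maxDeriv_of_periodic hψ hψper hi _) hYi
  rw [norm_iteratedFDeriv_eq_norm_iteratedDeriv, Real.norm_eq_abs] at this
  exact this.trans (le_of_eq (by ring))

/-! ### From quadrature errors to the difference of the two schemes. -/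

theorem innerG_add_right (b : ℝ → ℝ) (s : ℝ) (M k : ℕ) (f φ χ : ℝ → ℝ) :
    innerG b s M k f (φ + χ) = innerG b s M k f φ + innerG b s M k f χ := by
  simp only [innerG, gaussQuad, Pi.add_apply, mul_add, Finset.sum_add_distrib]

theorem innerG_smul_right (b : ℝ → ℝ) (s : ℝ) (M k : ℕ) (f φ : ℝ → ℝ) (c : ℝ) :
    innerG b s M k f (c • φ) = c * innerG b s M k f φ := by
  simp only [innerG, gaussQuad, Pi.smul_apply, smul_eq_mul, Finset.mul_sum]
  exact Finset.sum_congr rfl fun _ _ => Finset.sum_congr rfl fun _ _ =>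
    Finset.sum_congr rfl fun _ _ => by ring

/-- An estimate of the quadrature error bounds the difference of the two schemes. -/
theorem normL2_quadScheme_sub_exactScheme_le {b : ℝ → ℝ} {s : ℝ} {M k : ℕ} (hM : 0 < M)
    {f : ℝ → ℝ} {K : ℝ}
    (hint : ∀ φ ∈ dgSpace M k, IntervalIntegrable (fun x => transport b s f x * φ x) volume 0 1)
    (hK0 : 0 ≤ K) (hK : ∀ φ ∈ dgSpace M k,
      |innerG b s M k (transport b s f) φ - innerL2 (transport b s f) φ| ≤ K * normL2 φ) :
    normL2 (quadScheme b s M k f - exactScheme b s M k f) ≤ K := by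
  -- `dgElement` is zero by default, so its defining property requires linearity of the functional;
  -- for the exact scheme this rests on the integrability `hint`.
  obtain ⟨hq, hqe⟩ := dgElement_spec (k := k) hM
    (ℓ := fun φ => innerG b s M k (transport b s f) φ)
    (fun φ _ χ _ => innerG_add_right b s M k _ φ χ) (fun c φ _ => innerG_smul_right b s M k _ φ c)
  obtain ⟨he, hee⟩ := dgElement_spec (k := k) hM
    (ℓ := fun φ => innerL2 (transport b s f) φ)
    (fun φ hφ χ hχ => by
      simp only [innerL2, Pi.add_apply, mul_add]
      exact intervalIntegral.integral_add (hint φ hφ) (hint χ hχ))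
    (fun c φ _ => by simp [innerL2, mul_left_comm])
  change quadScheme b s M k f ∈ _ at hq
  change exactScheme b s M k f ∈ _ at he
  change ∀ φ ∈ _, innerL2 (quadScheme b s M k f) φ = _ at hqe
  change ∀ φ ∈ _, innerL2 (exactScheme b s M k f) φ = _ at hee
  set w := quadScheme b s M k f - exactScheme b s M k f with hw
  have hwV : w ∈ dgSpace M k := Submodule.sub_mem _ hq he
  -- Testing with the difference `w` itself turns its squared norm into a quadrature error.
  have hww : normL2 w ^ 2 =
      innerG b s M k (transport b s f) w - innerL2 (transport b s f) w := by
    rw [← hqe w hwV, ← hee w hwV, normL2, Real.sq_sqrt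
      (intervalIntegral.integral_nonneg zero_le_one fun _ _ => sq_nonneg _)]
    simp only [innerL2]
    rw [← intervalIntegral.integral_sub (dgSpace_integrable hM hq hwV)
      (dgSpace_integrable hM he hwV)]
    refine intervalIntegral.integral_congr fun x _ => ?_
    simp only [hw, Pi.sub_apply]; ring
  have h1 : normL2 w ^ 2 ≤ K * normL2 w := by
    rw [hww]; exact (le_abs_self _).trans (hK w hwV)
  have h0 : 0 ≤ normL2 w := Real.sqrt_nonneg _
  rcases h0.eq_or_lt with h0 | h0
  · rw [← h0]; exact hK0
  · rw [sq] at h1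
    exact le_of_mul_le_mul_right h1 h0

end SLDG
-- Assembly of the four estimates.
theorem mainTheorem6 (k : ℕ) :
    ∃ C₀ : ℝ, 0 ≤ C₀ ∧
    ∀ b : ℝ → ℝ, ContDiff ℝ ((2 * k + 2 : ℕ) : WithTop ℕ∞) b → Function.Periodic b 1 →
    ∀ T : ℝ, 0 < T →
    ∃ C : ℝ, 0 ≤ C ∧
    ∀ (M : ℕ) (Δt Δx : ℝ), 0 < M → Δx = 1 / (M : ℝ) → 0 < Δt → Δt ≤ T →
      -- (i)
      (∀ u ∈ SLDG.dgSpace M k, ∀ φ ∈ SLDG.dgSpace M k,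
        |SLDG.innerG b Δt M k (SLDG.transport b Δt u) φ
            - SLDG.innerL2 (SLDG.transport b Δt u) φ|
          ≤ C * Δt * Δx ^ 2 * SLDG.normL2 u * SLDG.normL2 φ) ∧
      (∀ u ∈ SLDG.dgSpace M k,
        SLDG.normL2 (SLDG.quadScheme b Δt M k u - SLDG.exactScheme b Δt M k u)
          ≤ C * Δt * Δx ^ 2 * SLDG.normL2 u) ∧
      -- (ii)
      (∀ u ∈ SLDG.dgSpace M k, ∀ ψ : ℝ → ℝ, ContDiff ℝ ((k + 1 : ℕ) : WithTop ℕ∞) ψ →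
        Function.Periodic ψ 1 → ∀ φ ∈ SLDG.dgSpace M k,
        |SLDG.innerG b Δt M k (SLDG.transport b Δt u - SLDG.transport b Δt ψ) φ
            - SLDG.innerL2 (SLDG.transport b Δt u - SLDG.transport b Δt ψ) φ|
          ≤ C * Δt * Δx ^ 2 * SLDG.normL2 (u - ψ) * SLDG.normL2 φ
            + C₀ * SLDG.maxDeriv (k + 1) ψ * Δx ^ (k + 1) * SLDG.normL2 φ) ∧
      -- (iii)
      (∀ ψ : ℝ → ℝ, ContDiffOn ℝ ((k + 1 : ℕ) : WithTop ℕ∞) ψ (Set.Icc 0 1) →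
        ∀ φ ∈ SLDG.dgSpace M k,
        |SLDG.innerG b Δt M k ψ φ - SLDG.innerL2 ψ φ|
          ≤ C₀ * SLDG.maxDeriv (k + 1) ψ * Δx ^ (k + 1) * SLDG.normL2 φ) ∧
      -- (iv)
      (∀ ψ : ℝ → ℝ, ContDiff ℝ ((k + 1 : ℕ) : WithTop ℕ∞) ψ → Function.Periodic ψ 1 →
        SLDG.normL2 (SLDG.quadScheme b Δt M k ψ - SLDG.exactScheme b Δt M k ψ)
          ≤ C * SLDG.maxDeriv (k + 1) ψ * Δx ^ (k + 1)) := by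
  obtain ⟨C₁, hC₁, H₁⟩ := SLDG.exists_innerG_smooth_error_le k
  obtain ⟨C₂, hC₂, H₂⟩ := SLDG.exists_innerG_transport_error_le k
  -- Both constants are fixed before `b` and `T`: `C₂` serves (ii) and `C₁` serves (iii).
  refine ⟨C₁ + C₂, by positivity, fun b hb hper T hT => ?_⟩
  have hb1 : ContDiff ℝ 1 b := hb.of_le (by exact_mod_cast (by omega : 1 ≤ 2 * k + 2))
  have hbk : ContDiff ℝ (k + 1 : ℕ) b := hb.of_le (by exact_mod_cast (by omega : k + 1 ≤ 2 * k + 2))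
  obtain ⟨C₃, hC₃, H₃⟩ := H₂ b hb hper T hT
  obtain ⟨C₄, hC₄, H₄⟩ := SLDG.exists_iteratedDeriv_comp_flow_le hb1 hper hbk hT
  -- `C₃` serves (i) and (ii), while `C₁ * C₄` serves (iv), where `C₄` bounds the derivatives of `ψ
  -- ∘ Y` in terms of those of `ψ`.
  refine ⟨C₃ + C₁ * C₄, by positivity, fun M Δt Δx hM hΔx hΔt hΔtT => ?_⟩
  have hn : ∀ f : ℝ → ℝ, 0 ≤ SLDG.normL2 f := fun f => Real.sqrt_nonneg _
  have hΔx0 : 0 ≤ Δx := by rw [hΔx]; positivity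
  have hi : ∀ u ∈ SLDG.dgSpace M k, ∀ φ ∈ SLDG.dgSpace M k,
      IntervalIntegrable (fun x => SLDG.transport b Δt u x * φ x) MeasureTheory.volume 0 1 ∧
      |SLDG.innerG b Δt M k (SLDG.transport b Δt u) φ
          - SLDG.innerL2 (SLDG.transport b Δt u) φ|
        ≤ (C₃ + C₁ * C₄) * Δt * Δx ^ 2 * SLDG.normL2 u * SLDG.normL2 φ := by
    intro u hu φ hφ
    -- For `ψ = 0` the approximation term vanishes.
    have h := H₃ Δt hΔt hΔtT M hM u hu 0 contDiff_const (fun _ => rfl) φ hφ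
    have e : SLDG.transport b Δt u - SLDG.transport b Δt 0 = SLDG.transport b Δt u := by
      funext x; simp [SLDG.transport]
    rw [e, sub_zero, SLDG.maxDeriv_zero, ← hΔx] at h
    refine ⟨h.1, h.2.trans ?_⟩
    have h1 := hn u
    have h2 := hn φ
    have : 0 ≤ C₁ * C₄ * Δt * Δx ^ 2 * SLDG.normL2 u * SLDG.normL2 φ := by positivity
    linarith
  refine ⟨fun u hu φ hφ => (hi u hu φ hφ).2, fun u hu => ?_, fun u hu ψ hψ hψper φ hφ => ?_,
    fun ψ hψ φ hφ => ?_, fun ψ hψ hψper => ?_⟩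
  · have h1 := hn u
    exact SLDG.normL2_quadScheme_sub_exactScheme_le hM (fun φ hφ => (hi u hu φ hφ).1)
      (by positivity) fun φ hφ => (hi u hu φ hφ).2
  · have h := (H₃ Δt hΔt hΔtT M hM u hu ψ hψ hψper φ hφ).2
    rw [← hΔx] at h
    refine h.trans ?_
    have h1 := hn (u - ψ)
    have h2 := hn φ
    have h3 := SLDG.maxDeriv_nonneg (k + 1) ψ
    gcongr
    · linarith [mul_nonneg hC₁ hC₄]
    · linarith
  · have h := (H₁ b hb1 hper Δt M hM ψ _ hψ
      (fun x hx => SLDG.abs_iteratedDeriv_le_maxDeriv hψ le_rfl hx) φ hφ).2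
    rw [← hΔx] at h
    refine h.trans ?_
    have h2 := hn φ
    have h3 := SLDG.maxDeriv_nonneg (k + 1) ψ
    gcongr
    linarith
  · obtain ⟨hc, hd⟩ := H₄ Δt hΔt hΔtT ψ hψ hψper
    have h3 := SLDG.maxDeriv_nonneg (k + 1) ψ
    have h := H₁ b hb1 hper Δt M hM (SLDG.transport b Δt ψ) _ hc.contDiffOn (fun x _ => hd x)
    rw [← hΔx] at h
    refine SLDG.normL2_quadScheme_sub_exactScheme_le hM (fun φ hφ => (h φ hφ).1) (by positivity)
      fun φ hφ => (h φ hφ).2.trans ?_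
    have h2 := hn φ
    have : 0 ≤ C₃ * SLDG.maxDeriv (k + 1) ψ * Δx ^ (k + 1) * SLDG.normL2 φ := by positivity
    linarith
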